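/- All rings are commutative with $1$. Let $R$ be a finite local principal ideal ring with maximal ideal $\mathfrak p=\pi R$ and residue field $k$. Its parameters $(a,e,f,p)$ are: the prime $p$ and the integer $f$ with $|k|=p^f$; the nilpotency index $a$ of $\mathfrak p$ (the least $n$ with $\mathfrak p^n=0$); and $e=\operatorname{ord}_{\mathfrak p}(p)$, where $\operatorname{ord}_{\mathfrak p}(r)=n$ if $r\in\mathfrak p^n\setminus\mathfrak p^{n+1}$ and $\operatorname{ord}_{\mathfrak p}(0)=a$. A uniformizer is a generator of $\mathfrak p$. A coefficient ring of $R$ is a local subring $S$ with maximal ideal $pS=S\cap\mathfrak p$ that maps onto $k$. A polynomial of degree $e$ over a ring $A$ is called $p$-Eisenstein if it is monic, all its other coefficients lie in $pA$, and its constant term is not in $p^2A$. Put $a_0=\lceil a/e\rceil$. If $e=a$, then $R\cong k[Y]/(Y^a)$, and $R$ is determined up to isomorphism by $a$, $f$, $p$: every finite local principal ideal ring with parameters $(a,a,f,p)$ is isomorphic to $R$. In all cases $R$ has a unique coefficient ring $R_\omega$. Let $\Delta$ be the set of $p$-Eisenstein polynomials of degree $e$ over $R_\omega$ that have a zero in $R$.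 If $a>e$, the following hold. 1. There is a $p$-Eisenstein polynomial $g\in R_\omega[Y]$ of degree $e$ with $g(\pi)=0$. 2. For this $g$, the ring $R_g=R_\omega[Y]/(g)$ is a finite local principal ideal ring with parameters $(a_0e,e,f,p)$, and $R\cong R_g/(\overline Y^{\,a})\cong R_\omega[Y]/(Y^a,g)$. 3. $R$ is determined up to isomorphism by its signature $(a,e,f,p,\Delta)$: if $R'$ is a finite local principal ideal ring with parameters $(a',e',f',p')$, coefficient ring $R'_\omega$ and corresponding set $\Delta'$, then $R\cong R'$ if and only if $(a,e,f,p)=(a',e',f',p')$ and there is a ring isomorphism $R_\omega\to R'_\omega$ that carries $\Delta$ onto $\Delta'$. 4. If $q\in\Delta$, $u\in R$ and $q(u)=0$, then $u$ is a uniformizer of $R$. Moreover, monic polynomials $h\in\mathbb Z[X]$ of degree $f$ that are irreducible mod $p$ exist. Every such $h$ has a zero in $R$, and for every such $h$ and every zero $b\in R$ of $h$ there is a polynomial $\hat g\in\mathbb Z[X,Y]$, monic of degree $e$ in $Y$, with $p$-Eisenstein image in $(\mathbb Z[X]/(h))[Y]$ and with $\hat g(b,Y)=g(Y)$, such that the following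 hold. 5. With $\beta$ the class of $X$ in $K=\mathbb Q[X]/(h)$ and $\gamma$ the class of $Y$ in $L=K[Y]/(\hat g(\beta,Y))$, $K\subseteq L$ are number fields, $[K:\mathbb Q]=f$, $p$ is inert in $\mathcal O_K$ (that is, $p\mathcal O_K$ is prime), $[L:K]=e$, and $p\mathcal O_K$ is totally ramified in $\mathcal O_L$: there is a unique prime $\mathfrak P_L$ of $\mathcal O_L$ above $p$, and $p\mathcal O_L=\mathfrak P_L^{\,e}$. The localization $D=\mathcal O_{L,\mathfrak P_L}$ is a discrete valuation ring with the same ramification index $e$ and residue degree $f$ over $p$ as $R$; one has $\gamma\in\mathcal O_L$, $\mathfrak P_L^{\,a}D=\gamma^aD$, and $R\cong D/\mathfrak P_L^{\,a}D$. 6. $\overline X\mapsto b$, $\overline Y\mapsto\pi$ defines an isomorphism $\mathbb Z[X,Y]/(p^{a_0},Y^a,\hat g(X,Y),h(X))\xrightarrow{\ \sim\ }R$. -/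

import Mathlib

open Polynomial IsLocalRing NumberField

universe u v

/-- The local ring `R` has parameters `(a, e, f, p)`: the residue field has `p ^ f` elements with `p`
prime, `a` is the nilpotency index of the maximal ideal, and `e` is the order of `p` at the maximal
ideal, where the order of `0` is `a` by convention. -/
structure HasParameters (R : Type*) [CommRing R] [IsLocalRing R] (a e f p : ℕ) : Prop where
  prime : p.Prime
  card_residueField : Nat.card (ResidueField R) = p ^ f
  nilpotencyIndex : IsLeast {n : ℕ | maximalIdeal R ^ n = ⊥} a
  ramificationIndex : ((p : R) = 0 ∧ e = a) ∨
    ((p : R) ∈ maximalIdeal R ^ e ∧ (p : R) ∉ maximalIdeal R ^ (e + 1))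

/-- `R` is a finite local principal ideal ring of type `(a, e, f, p)`. -/
def IsFiniteLocalPIR (R : Type*) [CommRing R] (a e f p : ℕ) : Prop :=
  ∃ _ : IsLocalRing R, Finite R ∧ IsPrincipalIdealRing R ∧ HasParameters R a e f p

/-- A uniformizer is a generator of the maximal ideal. -/
def IsUniformizer (R : Type*) [CommRing R] [IsLocalRing R] (u : R) : Prop :=
  maximalIdeal R = Ideal.span {u}

/-- `S` is a coefficient ring of the finite local ring `R` of residue characteristic `p`: a local
subring with maximal ideal `p S = S ∩ 𝔪` and the same residue field as `R`. (Completeness of `S` is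
automatic, as `S` is finite.) -/
structure IsCoefficientRing (R : Type*) [CommRing R] [IsLocalRing R] (p : ℕ) (S : Subring R) :
    Prop where
  isLocalRing : IsLocalRing S
  maximalIdeal_eq : maximalIdeal S = Ideal.span {(p : S)}
  comap_eq : (maximalIdeal R).comap S.subtype = Ideal.span {(p : S)}
  residue_surjective : Function.Surjective ((residue R).comp S.subtype)

/-- `q` is a `p`-Eisenstein polynomial of degree `e`: monic, with all other coefficients in `p A` and
constant term not in `p² A`. -/
def IsPEisenstein {A : Type*} [CommRing A] (p e : ℕ) (q : A[X]) : Prop :=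
  q.Monic ∧ q.natDegree = e ∧ q.IsEisensteinAt (Ideal.span {(p : A)})

/-- The set `Δ` of the `p`-Eisenstein polynomials of degree `e` over the subring `S` that have a zero
in `R`. -/
def eisensteinWithZero {R : Type*} [CommRing R] (S : Subring R) (p e : ℕ) : Set S[X] :=
  {q | IsPEisenstein p e q ∧ ∃ u : R, q.eval₂ S.subtype u = 0}

/-- `h` is a monic integer polynomial of degree `f` that is irreducible mod `p`. -/
def IsInertPolynomial (f p : ℕ) (h : ℤ[X]) : Prop :=
  h.Monic ∧ h.natDegree = f ∧ Irreducible (h.map (Int.castRingHom (ZMod p)))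

/-- The number field model of `R` attached to `h ∈ ℤ[X]` and `G ∈ ℤ[X][Y]`. Here `K = ℚ[X]/(h)`, with
`β` the class of `X`, and `L = K[Y]/(G(β, Y))`, with `γ` the class of `Y`; both are fields, of degree
`[K : ℚ] = f` and `[L : K] = e`; the ideal `p 𝓞_K` is prime; there is a unique prime `P` of `𝓞_L` above
`p`, and `p 𝓞_L = P ^ e`. The localization `D` of `𝓞_L` at `P` is a discrete valuation ring, in which
`p` has order `e` and whose residue field has degree `f` over the prime field; one has
`P ^ a D = γ ^ a D`, and `R` is isomorphic to `D / P ^ a D`. -/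
def HasNumberFieldModel (R : Type*) [CommRing R] (a e f p : ℕ) (h : ℤ[X]) (G : ℤ[X][X]) : Prop :=
  ∃ (K : Type) (_ : Field K) (_ : NumberField K)
    (hK : IsAdjoinRoot K (h.map (Int.castRingHom ℚ)))
    (L : Type) (_ : Field L) (_ : NumberField L) (_ : Algebra K L)
    (hL : IsAdjoinRoot L (G.map (aeval hK.root : ℤ[X] →ₐ[ℤ] K).toRingHom)),
    Module.finrank ℚ K = f ∧
    Module.finrank K L = e ∧
    (Ideal.span {(p : 𝓞 K)}).IsPrime ∧
    ∃ (P : Ideal (𝓞 L)) (_ : P.IsPrime),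
      P.LiesOver (Ideal.span {(p : ℤ)}) ∧
      (∀ Q : Ideal (𝓞 L), Q.IsPrime → Q.LiesOver (Ideal.span {(p : ℤ)}) → Q = P) ∧
      (Ideal.span {(p : 𝓞 K)}).map (algebraMap (𝓞 K) (𝓞 L)) = P ^ e ∧
      IsDiscreteValuationRing (Localization.AtPrime P) ∧
      Ideal.span {(p : Localization.AtPrime P)} = maximalIdeal (Localization.AtPrime P) ^ e ∧
      Nat.card (ResidueField (Localization.AtPrime P)) = p ^ f ∧
      (∃ γ : 𝓞 L, (γ : L) = hL.root ∧
        (P ^ a).map (algebraMap (𝓞 L) (Localization.AtPrime P)) =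
          Ideal.span {algebraMap (𝓞 L) (Localization.AtPrime P) γ ^ a}) ∧
      Nonempty (R ≃+* Localization.AtPrime P ⧸
        (P ^ a).map (algebraMap (𝓞 L) (Localization.AtPrime P)))

/-- The ideal `(m, Y ^ a, G(X, Y), h(X))` of `ℤ[X, Y] = ℤ[X][Y]`. -/
noncomputable def presentationIdeal (m a : ℕ) (h : ℤ[X]) (G : ℤ[X][X]) : Ideal ℤ[X][X] :=
  Ideal.span {(m : ℤ[X][X]), X ^ a, G, C h}

/-! The engine is a dichotomy: `y` is nilpotent and every element is a unit or a multiple of `y`.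
Such a nontrivial ring is local and principal, and each element is a unit times a power of `y`. A
homomorphism `φ` out of it, with `y ^ a = 0`, is bijective as soon as no power of `φ y` below the
`a`-th vanishes and every class modulo `φ y` is hit (`bijective_of_forall_exists_dvd_sub`). The
quotient presentations of `R` and of `D / P ^ a D` come from this criterion; Eisenstein relations
supply the dichotomy, since they read `y ^ e = p * unit`.

The coefficient ring is `ℤ[b]`, where `b` is a Hensel lift of a root of `h` in the residue field.
Uniqueness of Hensel lifts puts `b` into every coefficient ring, and `p`-adic approximation shows
that `b` generates it. When `e < a`, one has `p = w * π ^ e` with `w` a unit; expanding `-w⁻¹` in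
`1, π, …, π ^ (e - 1)` over `S` turns this into an Eisenstein equation for `π`. An isomorphism of
coefficient rings matching the sets `Δ` sends `g` to a polynomial with a zero in `R'`. That zero is
a uniformizer, so both rings have the same presentation.

For the number fields, counting replaces any study of the index of `ℤ[β]`: `𝓞 K / p` has `p ^ f`
elements and contains a root of `h`, hence is a field. In `𝓞 L` the relation `γ ^ e = p * w` and a
norm comparison force `p 𝓞 L = P ^ e` with residue field of size `p ^ f`. Finally `R` and `D / P ^ a
D` are both identified with the same quotient of `ℤ[X][Y]`. -/

/-! ### Rings in which every element is a unit or a multiple of a fixed nilpotent -/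

section NilpotentGenerator

variable {A B C : Type*} [CommRing A] [CommRing B] [CommRing C] {y : A}

theorem IsNilpotent.not_isUnit_of_dvd [Nontrivial A] (hy : IsNilpotent y) {x : A} (hx : y ∣ x) :
    ¬ IsUnit x := fun h => hy.not_isUnit (isUnit_of_dvd_unit hx h)

theorem isLocalRing_of_forall_isUnit_or_dvd [Nontrivial A] (hy : IsNilpotent y)
    (h : ∀ x, IsUnit x ∨ y ∣ x) : IsLocalRing A := by
  refine IsLocalRing.of_nonunits_add fun x z hx hz => ?_
  exact hy.not_isUnit_of_dvd (dvd_add ((h x).resolve_left hx) ((h z).resolve_left hz))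

theorem maximalIdeal_eq_span_of_forall_isUnit_or_dvd [IsLocalRing A] (hy : IsNilpotent y)
    (h : ∀ x, IsUnit x ∨ y ∣ x) : maximalIdeal A = Ideal.span {y} := by
  ext x
  rw [mem_maximalIdeal, Ideal.mem_span_singleton, mem_nonunits_iff]
  exact ⟨(h x).resolve_left, hy.not_isUnit_of_dvd⟩

theorem isUnit_or_dvd_of_maximalIdeal_eq [IsLocalRing A] (h : maximalIdeal A = Ideal.span {y})
    (x : A) : IsUnit x ∨ y ∣ x := by
  rw [← Ideal.mem_span_singleton, ← h, mem_maximalIdeal, mem_nonunits_iff]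
  exact em _

theorem exists_isUnit_mul_pow (hy : IsNilpotent y) (h : ∀ x, IsUnit x ∨ y ∣ x) (x : A) :
    ∃ n u, IsUnit u ∧ x = u * y ^ n := by
  have key : ∀ N : ℕ, (∃ n u, IsUnit u ∧ x = u * y ^ n) ∨ y ^ N ∣ x := by
    intro N
    induction N with
    | zero => simp
    | succ N ih =>
      rcases ih with ih | ⟨z, hz⟩
      · exact Or.inl ih
      · rcases h z with hu | ⟨w, hw⟩
        · exact Or.inl ⟨N, z, hu, by rw [hz, mul_comm]⟩
        · exact Or.inr ⟨w, by rw [hz, hw, pow_succ, mul_assoc]⟩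
  obtain ⟨N, hN⟩ := hy
  rcases key N with h | ⟨z, hz⟩
  · exact h
  · exact ⟨N, 1, isUnit_one, by rw [hz, hN]; simp⟩

/-- An ideal is generated by the smallest power of `y` that it contains. -/
theorem isPrincipalIdealRing_of_forall_isUnit_or_dvd (hy : IsNilpotent y)
    (h : ∀ x, IsUnit x ∨ y ∣ x) : IsPrincipalIdealRing A := by
  classical
  refine ⟨fun I => ?_⟩
  have hex : ∃ n, y ^ n ∈ I := by
    obtain ⟨N, hN⟩ := hy
    exact ⟨N, by rw [hN]; exact I.zero_mem⟩
  refine ⟨y ^ Nat.find hex, le_antisymm (fun x hx => ?_) ?_⟩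
  · obtain ⟨n, u, hu, rfl⟩ := exists_isUnit_mul_pow hy h x
    have hn : y ^ n ∈ I := (Ideal.unit_mul_mem_iff_mem I hu).1 hx
    exact Ideal.mem_span_singleton.2 ((pow_dvd_pow y (Nat.find_min' hex hn)).mul_left u)
  · exact (Ideal.span_singleton_le_iff_mem I).2 (Nat.find_spec hex)

/-- The constant coefficient decides: the remaining terms sum to a multiple of the nilpotent `y`,
which changes neither invertibility nor divisibility by `y`. -/
theorem forall_isUnit_or_dvd_of_surjective (ι : C →+* A)
    (hs : Function.Surjective (eval₂RingHom ι y)) (hy : IsNilpotent y)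
    (hc : ∀ c, IsUnit (ι c) ∨ y ∣ ι c) (x : A) : IsUnit x ∨ y ∣ x := by
  obtain ⟨P, rfl⟩ := hs x
  have hP : eval₂RingHom ι y P = ι (P.coeff 0) + y * eval₂ ι y P.divX := by
    conv_lhs => rw [← P.divX_mul_X_add]
    simp only [coe_eval₂RingHom, eval₂_add, eval₂_mul, eval₂_X, eval₂_C]
    ring
  rw [hP]
  have hn : IsNilpotent (y * eval₂ ι y P.divX) := (Commute.all _ _).isNilpotent_mul_right hy
  rcases hc (P.coeff 0) with h | h
  · exact Or.inl (by rw [add_comm]; exact hn.isUnit_add_right_of_commute h (Commute.all _ _))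
  · exact Or.inr (dvd_add h (dvd_mul_right _ _))

/-- Successive approximation: an error `φ y ^ N * c` is corrected by approximating `c`, and
nilpotency ends the process. -/
theorem surjective_of_forall_exists_dvd_sub (φ : A →+* B) (hy : IsNilpotent (φ y))
    (hres : ∀ b, ∃ x, φ y ∣ b - φ x) : Function.Surjective φ := by
  intro b
  have key : ∀ N : ℕ, ∃ x, φ y ^ N ∣ b - φ x := by
    intro N
    induction N with
    | zero => simp
    | succ N ih =>
      obtain ⟨x, c, hc⟩ := ih
      obtain ⟨z, d, hd⟩ := hres c
      refine ⟨x + y ^ N * z, d, ?_⟩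
      rw [map_add, map_mul, map_pow]
      linear_combination hc + φ y ^ N * hd
  obtain ⟨N, hN⟩ := hy
  obtain ⟨x, hx⟩ := key N
  rw [hN, zero_dvd_iff, sub_eq_zero] at hx
  exact ⟨x, hx.symm⟩

/-- For injectivity, a kernel element is `u * y ^ n` with `u` a unit, so `φ y ^ n = 0`; then `a ≤ n`
and the element was already zero. -/
theorem bijective_of_forall_exists_dvd_sub (φ : A →+* B) {a : ℕ} (ha : y ^ a = 0)
    (hA : ∀ x, IsUnit x ∨ y ∣ x) (hres : ∀ b, ∃ x, φ y ∣ b - φ x)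
    (hmin : ∀ j, φ y ^ j = 0 → a ≤ j) : Function.Bijective φ := by
  refine ⟨(injective_iff_map_eq_zero φ).2 fun x hx => ?_,
    surjective_of_forall_exists_dvd_sub φ ⟨a, by rw [← map_pow, ha, map_zero]⟩ hres⟩
  obtain ⟨n, u, hu, rfl⟩ := exists_isUnit_mul_pow ⟨a, ha⟩ hA x
  rw [map_mul, (hu.map φ).mul_right_eq_zero, map_pow] at hx
  rw [pow_eq_zero_of_le (hmin n hx) ha, mul_zero]

end NilpotentGenerator

/-! ### The relation satisfied by a zero of an Eisenstein polynomial -/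

section EisensteinRelation

variable {A C : Type*} [CommRing A] [CommRing C] {y ϖ d : A} {e : ℕ} {g : C[X]}

theorem exists_pow_eq_of_eval₂_eq_zero (ι : C →+* A) (hg : g.Monic) (hdeg : g.natDegree = e)
    (he : 0 < e) (hz : g.eval₂ ι y = 0) (hdvd : ∀ i < e, ϖ ∣ ι (g.coeff i))
    (h0 : ι (g.coeff 0) = ϖ * d) : ∃ t, y ^ e = ϖ * -(d + y * t) := by
  obtain ⟨n, rfl⟩ : ∃ n, e = n + 1 := ⟨e - 1, by omega⟩
  choose! s hs using hdvd
  rw [hg.as_sum, hdeg, eval₂_add, eval₂_finsetSum, Finset.sum_range_succ'] at hz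
  simp only [eval₂_X_pow, eval₂_mul, eval₂_C, pow_zero, mul_one, h0] at hz
  refine ⟨∑ i ∈ Finset.range n, s (i + 1) * y ^ i, ?_⟩
  have : ∑ i ∈ Finset.range n, ι (g.coeff (i + 1)) * y ^ (i + 1) =
      ϖ * (y * ∑ i ∈ Finset.range n, s (i + 1) * y ^ i) := by
    rw [Finset.mul_sum, Finset.mul_sum]
    refine Finset.sum_congr rfl fun i hi => ?_
    rw [hs (i + 1) (by have := Finset.mem_range.1 hi; omega)]
    ring
  rw [this] at hz
  linear_combination hz

/-- Every middle term carries both `ϖ` and `y`. So `y ^ e` is a multiple of `ϖ`, which makes `y`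
nilpotent, and then the cofactor `-(d + y * t)` is a unit because `d` is. -/
theorem exists_isUnit_pow_eq_of_eval₂_eq_zero (ι : C →+* A) (hg : g.Monic)
    (hdeg : g.natDegree = e) (he : 0 < e) (hz : g.eval₂ ι y = 0)
    (hdvd : ∀ i < e, ϖ ∣ ι (g.coeff i)) (h0 : ι (g.coeff 0) = ϖ * d) (hd : IsUnit d)
    (hϖ : IsNilpotent ϖ) : IsNilpotent y ∧ ∃ w, IsUnit w ∧ y ^ e = ϖ * w := by
  obtain ⟨t, ht⟩ := exists_pow_eq_of_eval₂_eq_zero ι hg hdeg he hz hdvd h0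
  have hy : IsNilpotent y := by
    have : IsNilpotent (y ^ e) := ht ▸ (Commute.all _ _).isNilpotent_mul_right hϖ
    obtain ⟨n, hn⟩ := this
    exact ⟨e * n, by rw [pow_mul, hn]⟩
  refine ⟨hy, _, ?_, ht⟩
  rw [IsUnit.neg_iff, add_comm]
  exact ((Commute.all _ _).isNilpotent_mul_right hy).isUnit_add_right_of_commute hd
    (Commute.all _ _)

/-- The monic polynomial of degree `e` with prescribed lower coefficients. -/
noncomputable def monicOfCoeff (e : ℕ) (c : ℕ → C) : C[X] :=
  X ^ e + ∑ i ∈ Finset.range e, Polynomial.C (c i) * X ^ i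

theorem degree_sum_monicOfCoeff (e : ℕ) (c : ℕ → C) :
    (∑ i ∈ Finset.range e, Polynomial.C (c i) * X ^ i).degree < (e : WithBot ℕ) := by
  rw [degree_lt_iff_coeff_zero]
  intro m hm
  simp [hm]

theorem monic_monicOfCoeff (e : ℕ) (c : ℕ → C) : (monicOfCoeff e c).Monic :=
  monic_X_pow_add (degree_sum_monicOfCoeff e c)

theorem natDegree_monicOfCoeff [Nontrivial C] (e : ℕ) (c : ℕ → C) :
    (monicOfCoeff e c).natDegree = e := by
  refine natDegree_eq_of_degree_eq_some ?_
  rw [monicOfCoeff, degree_add_eq_left_of_degree_lt] <;> rw [degree_X_pow]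
  exact degree_sum_monicOfCoeff e c

theorem coeff_monicOfCoeff {e : ℕ} (c : ℕ → C) {i : ℕ} (hi : i < e) :
    (monicOfCoeff e c).coeff i = c i := by
  simp [monicOfCoeff, coeff_X_pow, hi.ne, hi]

theorem map_monicOfCoeff (f : C →+* A) (e : ℕ) (c : ℕ → C) :
    (monicOfCoeff e c).map f = monicOfCoeff e (fun i => f (c i)) := by
  simp [monicOfCoeff, Polynomial.map_sum]

theorem monicOfCoeff_coeff (hg : g.Monic) (hdeg : g.natDegree = e) :
    monicOfCoeff e g.coeff = g := by
  conv_rhs => rw [hg.as_sum, hdeg]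
  rfl

theorem monicOfCoeff_congr {c c' : ℕ → C} (h : ∀ i < e, c i = c' i) :
    monicOfCoeff e c = monicOfCoeff e c' := by
  rw [monicOfCoeff, monicOfCoeff]
  congr 1
  exact Finset.sum_congr rfl fun i hi => by rw [h i (Finset.mem_range.1 hi)]

theorem eval₂_monicOfCoeff (f : C →+* A) (e : ℕ) (c : ℕ → C) (y : A) :
    (monicOfCoeff e c).eval₂ f y = y ^ e + ∑ i ∈ Finset.range e, f (c i) * y ^ i := by
  simp [monicOfCoeff, eval₂_finsetSum]

end EisensteinRelation

/-! ### Integer polynomials irreducible mod `p` -/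

section InertPolynomial

variable {f p : ℕ} {h : ℤ[X]}

theorem IsInertPolynomial.monic (hh : IsInertPolynomial f p h) : h.Monic := hh.1

theorem exists_isInertPolynomial (hp : p.Prime) (hf : f ≠ 0) : ∃ h, IsInertPolynomial f p h := by
  have : Fact p.Prime := ⟨hp⟩
  obtain ⟨α, hα⟩ := Field.exists_primitive_element (ZMod p) (GaloisField p f)
  have hi : IsIntegral (ZMod p) α := Algebra.IsIntegral.isIntegral α
  have hdeg : (minpoly (ZMod p) α).natDegree = f := by
    rw [← IntermediateField.adjoin.finrank hi, hα, IntermediateField.finrank_top',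
      GaloisField.finrank p hf]
  obtain ⟨h, hmap, hnd, hmon⟩ := lifts_and_natDegree_eq_and_monic
    ((mem_lifts _).2 (map_surjective (Int.castRingHom (ZMod p)) (ZMod.ringHom_surjective _)
      (minpoly (ZMod p) α))) (minpoly.monic hi)
  exact ⟨h, hmon, hnd.trans hdeg, hmap ▸ minpoly.irreducible hi⟩

theorem exists_eq_C_mul_of_map_eq_zero {P : ℤ[X]}
    (hP : P.map (Int.castRingHom (ZMod p)) = 0) : ∃ s, P = (p : ℤ[X]) * s := by
  have : (C (p : ℤ)) ∣ P := by
    rw [C_dvd_iff_dvd_coeff]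
    intro i
    rw [← ZMod.intCast_zmod_eq_zero_iff_dvd]
    simpa using congrArg (fun q => q.coeff i) hP
  simpa [dvd_def] using this

/-- Maximality of `(p, h)` in `ℤ[X]`, with explicit witnesses so that it can be pushed through any
homomorphism; it is Bézout in `𝔽_p[X]`, lifted. -/
theorem IsInertPolynomial.mem_or_exists_inverse (hp : p.Prime) (hh : IsInertPolynomial f p h)
    (P : ℤ[X]) : (∃ s t, P = p * s + h * t) ∨ ∃ P' s t, P * P' = 1 + (p * s + h * t) := by
  have : Fact p.Prime := ⟨hp⟩
  have hsurj := map_surjective (Int.castRingHom (ZMod p)) (ZMod.ringHom_surjective _)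
  rcases (dvd_or_isCoprime (h.map (Int.castRingHom (ZMod p)))
    (P.map (Int.castRingHom (ZMod p))) hh.2.2) with ⟨t, ht⟩ | ⟨u, v, huv⟩
  · left
    obtain ⟨t, rfl⟩ := hsurj t
    obtain ⟨s, hs⟩ := exists_eq_C_mul_of_map_eq_zero (p := p) (P := P - h * t) (by simp [ht])
    exact ⟨s, t, by linear_combination hs⟩
  · right
    obtain ⟨u, rfl⟩ := hsurj u
    obtain ⟨v, rfl⟩ := hsurj v
    obtain ⟨s, hs⟩ := exists_eq_C_mul_of_map_eq_zero (p := p) (P := P * v + h * u - 1)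
      (by simp only [Polynomial.map_sub, Polynomial.map_add, Polynomial.map_mul,
            Polynomial.map_one]; linear_combination huv)
    exact ⟨v, s, -u, by linear_combination hs⟩

theorem IsInertPolynomial.isUnit_or_dvd (hp : p.Prime) (hh : IsInertPolynomial f p h)
    {A : Type*} [CommRing A] (hpn : IsNilpotent (p : A)) (φ : ℤ[X] →+* A) (hφ : φ h = 0)
    (P : ℤ[X]) : IsUnit (φ P) ∨ (p : A) ∣ φ P := by
  rcases hh.mem_or_exists_inverse hp P with ⟨s, t, rfl⟩ | ⟨P', s, t, hP⟩
  · exact Or.inr (by simp [hφ])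
  · left
    refine isUnit_of_mul_isUnit_left (y := φ P') ?_
    rw [← map_mul, hP]
    simp only [map_add, map_one, map_mul, map_natCast, hφ, zero_mul, add_zero]
    exact ((Commute.all _ _).isNilpotent_mul_right hpn).isUnit_one_add

theorem IsInertPolynomial.exists_eq_of_map_eq_zero (hp : p.Prime) (hh : IsInertPolynomial f p h)
    {A : Type*} [CommRing A] [Nontrivial A] (φ : ℤ[X] →+* A) (hpA : (p : A) = 0)
    (hφ : φ h = 0) {P : ℤ[X]} (hP : φ P = 0) : ∃ s t, P = p * s + h * t := by
  rcases hh.mem_or_exists_inverse hp P with h1 | ⟨P', s, t, h1⟩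
  · exact h1
  · have := congrArg φ h1
    simp [hP, hφ, hpA] at this

theorem charP_of_prime_of_cast_eq_zero {Q : Type*} [CommRing Q] [Nontrivial Q] (hp : p.Prime)
    (hpQ : (p : Q) = 0) : CharP Q p := by
  obtain ⟨q, hq⟩ := CharP.exists Q
  rcases (Nat.dvd_prime hp).1 ((CharP.cast_eq_zero_iff Q q p).1 hpQ) with h1 | h1
  · subst h1
    exact absurd rfl (CharP.char_ne_one Q 1)
  · exact h1 ▸ hq

theorem IsInertPolynomial.card_adjoinRoot (hp : p.Prime) (hh : IsInertPolynomial f p h) :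
    Nat.card (AdjoinRoot (h.map (Int.castRingHom (ZMod p)))) = p ^ f := by
  have : Fact p.Prime := ⟨hp⟩
  have hm := hh.monic.map (Int.castRingHom (ZMod p))
  have := hm.finite_adjoinRoot
  rw [Module.natCard_eq_pow_finrank (K := ZMod p), Nat.card_zmod,
    (AdjoinRoot.powerBasis' hm).finrank, AdjoinRoot.powerBasis'_dim, hh.monic.natDegree_map, hh.2.1]

/-- The root gives a map from the field `𝔽_p[X] / (h)` of `p ^ f` elements, automatically injective;
equal cardinality makes it onto. -/
theorem IsInertPolynomial.pow_le_card_and_surjective (hp : p.Prime)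
    (hh : IsInertPolynomial f p h) {Q : Type*} [CommRing Q] [Nontrivial Q] [Finite Q]
    (hpQ : (p : Q) = 0) {β : Q} (hβ : aeval β h = 0) :
    p ^ f ≤ Nat.card Q ∧
      (Nat.card Q = p ^ f → Function.Surjective (aeval β : ℤ[X] →ₐ[ℤ] Q)) := by
  have : Fact p.Prime := ⟨hp⟩
  have := Fact.mk hh.2.2
  have := charP_of_prime_of_cast_eq_zero hp hpQ
  have hcomp : (ZMod.castHom (dvd_refl p) Q).comp (Int.castRingHom (ZMod p)) =
      algebraMap ℤ Q := RingHom.ext_int _ _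
  let ψ : AdjoinRoot (h.map (Int.castRingHom (ZMod p))) →+* Q :=
    AdjoinRoot.lift (ZMod.castHom (dvd_refl p) Q) β (by rw [eval₂_map, hcomp]; exact hβ)
  have hψ : Function.Injective ψ := ψ.injective
  refine ⟨hh.card_adjoinRoot hp ▸ Nat.card_le_card_of_injective ψ hψ, fun hQ x => ?_⟩
  have hb : Function.Bijective ψ := by
    have := Finite.of_injective ψ hψ
    exact (Nat.bijective_iff_injective_and_card ψ).2 ⟨hψ, by rw [hQ, hh.card_adjoinRoot hp]⟩
  obtain ⟨z, rfl⟩ := hb.2 x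
  obtain ⟨z, rfl⟩ := AdjoinRoot.mk_surjective z
  obtain ⟨z, rfl⟩ := map_surjective (Int.castRingHom (ZMod p)) (ZMod.ringHom_surjective _) z
  refine ⟨z, ?_⟩
  simp only [ψ, AdjoinRoot.lift_mk]
  rw [eval₂_map, hcomp]; rfl

theorem IsInertPolynomial.isField_of_card (hp : p.Prime)
    (hh : IsInertPolynomial f p h) {Q : Type*} [CommRing Q] [Nontrivial Q] [Finite Q]
    (hpQ : (p : Q) = 0) {β : Q} (hβ : aeval β h = 0) (hQ : Nat.card Q = p ^ f) : IsField Q := by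
  refine ⟨exists_pair_ne Q, mul_comm, fun {x} hx => ?_⟩
  obtain ⟨P, rfl⟩ := (hh.pow_le_card_and_surjective hp hpQ hβ).2 hQ x
  rcases hh.isUnit_or_dvd hp (by rw [hpQ]; exact IsNilpotent.zero)
    (aeval β : ℤ[X] →ₐ[ℤ] Q).toRingHom hβ P with h1 | h1
  · exact h1.exists_right_inv
  · rw [hpQ, zero_dvd_iff] at h1
    exact absurd h1 hx

theorem IsInertPolynomial.exists_root_of_card (hp : p.Prime) (hh : IsInertPolynomial f p h)
    {k : Type*} [Field k] (hk : Nat.card k = p ^ f) : ∃ β : k, aeval β h = 0 := by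
  have : Fact p.Prime := ⟨hp⟩
  have := Fact.mk hh.2.2
  have h1 : Nat.card (AdjoinRoot (h.map (Int.castRingHom (ZMod p)))) = Nat.card k := by
    rw [hk, hh.card_adjoinRoot hp]
  have hpos : 0 < p ^ f := pow_pos hp.pos f
  have : Finite k := Nat.finite_of_card_ne_zero (by omega)
  have : Finite (AdjoinRoot (h.map (Int.castRingHom (ZMod p)))) :=
    Nat.finite_of_card_ne_zero (by omega)
  have := Fintype.ofFinite k
  have := Fintype.ofFinite (AdjoinRoot (h.map (Int.castRingHom (ZMod p))))
  let ψ := FiniteField.ringEquivOfCardEq (by simpa [Nat.card_eq_fintype_card] using h1)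
  refine ⟨ψ (AdjoinRoot.root _), ?_⟩
  have h2 := congrArg ψ (AdjoinRoot.eval₂_root (h.map (Int.castRingHom (ZMod p))))
  rw [eval₂_map, ← RingEquiv.coe_toRingHom, hom_eval₂, map_zero] at h2
  rw [aeval_def, ← h2]
  congr 1
  exact RingHom.ext_int _ _

theorem IsInertPolynomial.aeval_derivative_ne_zero (hp : p.Prime) (hh : IsInertPolynomial f p h)
    {k : Type*} [Field k] (hpk : (p : k) = 0) {β : k} (hβ : aeval β h = 0) :
    aeval β (derivative h) ≠ 0 := by
  have : Fact p.Prime := ⟨hp⟩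
  have := charP_of_prime_of_cast_eq_zero hp hpk
  have hcomp : (ZMod.castHom (dvd_refl p) k).comp (Int.castRingHom (ZMod p)) =
      algebraMap ℤ k := RingHom.ext_int _ _
  have hsep := PerfectField.separable_of_irreducible hh.2.2
  have := hsep.eval₂_derivative_ne_zero (ZMod.castHom (dvd_refl p) k) (x := β)
    (by rw [eval₂_map, hcomp]; exact hβ)
  rwa [derivative_map, eval₂_map, hcomp] at this

end InertPolynomial

/-! ### Consequences and invariance of the parameters -/

section Parameters

variable {R : Type*} [CommRing R] [IsLocalRing R] {a e f p : ℕ} {π : R}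

theorem HasParameters.f_ne_zero (hR : HasParameters R a e f p) : f ≠ 0 := by
  rintro rfl
  have h := hR.card_residueField
  rw [pow_zero, Nat.card_eq_one_iff_unique] at h
  exact not_subsingleton (ResidueField R) h.1

theorem HasParameters.finite_residueField (hR : HasParameters R a e f p) :
    Finite (ResidueField R) := by
  refine Nat.finite_of_card_ne_zero ?_
  rw [hR.card_residueField]
  exact pow_ne_zero _ hR.prime.ne_zero

theorem HasParameters.cast_residueField (hR : HasParameters R a e f p) :
    (p : ResidueField R) = 0 := by
  have := hR.finite_residueField
  have := Fintype.ofFinite (ResidueField R)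
  have h := FiniteField.cast_card_eq_zero (ResidueField R)
  rw [← Nat.card_eq_fintype_card, hR.card_residueField, Nat.cast_pow] at h
  exact pow_eq_zero_iff hR.f_ne_zero |>.1 h

theorem HasParameters.cast_mem (hR : HasParameters R a e f p) : (p : R) ∈ maximalIdeal R := by
  rw [← residue_eq_zero_iff, map_natCast]
  exact hR.cast_residueField

theorem HasParameters.pow_eq_zero (hR : HasParameters R a e f p) (hπ : IsUniformizer R π) :
    π ^ a = 0 := by
  have := hR.nilpotencyIndex.1
  rwa [Set.mem_ofPred_eq, hπ, Ideal.span_singleton_pow, Ideal.span_singleton_eq_bot] at this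

theorem HasParameters.le_of_pow_eq_zero (hR : HasParameters R a e f p) (hπ : IsUniformizer R π)
    {j : ℕ} (hj : π ^ j = 0) : a ≤ j := by
  refine hR.nilpotencyIndex.2 ?_
  rwa [Set.mem_ofPred_eq, hπ, Ideal.span_singleton_pow, Ideal.span_singleton_eq_bot]

theorem HasParameters.a_pos (hR : HasParameters R a e f p) : 0 < a := by
  rcases Nat.eq_zero_or_pos a with rfl | h
  · have := hR.nilpotencyIndex.1
    simp at this
  · exact h

theorem HasParameters.isNilpotent_of_mem (hR : HasParameters R a e f p) {x : R}
    (hx : x ∈ maximalIdeal R) : IsNilpotent x := by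
  refine ⟨a, ?_⟩
  have := Ideal.pow_mem_pow hx a
  rwa [hR.nilpotencyIndex.1] at this

theorem HasParameters.isNilpotent_uniformizer (hR : HasParameters R a e f p)
    (hπ : IsUniformizer R π) : IsNilpotent π := ⟨a, hR.pow_eq_zero hπ⟩

theorem HasParameters.isNilpotent_cast (hR : HasParameters R a e f p) : IsNilpotent (p : R) :=
  hR.isNilpotent_of_mem hR.cast_mem

theorem HasParameters.e_pos (hR : HasParameters R a e f p) : 0 < e := by
  rcases hR.ramificationIndex with ⟨_, rfl⟩ | ⟨_, h⟩
  · exact hR.a_pos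
  · rcases Nat.eq_zero_or_pos e with rfl | he
    · simp [hR.cast_mem] at h
    · exact he

theorem HasParameters.cast_eq_zero (hR : HasParameters R a a f p) : (p : R) = 0 := by
  rcases hR.ramificationIndex with ⟨h, _⟩ | ⟨h, _⟩
  · exact h
  · rwa [hR.nilpotencyIndex.1] at h

theorem HasParameters.cast_eq_mul_pow (hR : HasParameters R a e f p) (hπ : IsUniformizer R π)
    (hea : e < a) : ∃ w, IsUnit w ∧ (p : R) = w * π ^ e := by
  obtain ⟨h1, h2⟩ := hR.ramificationIndex.resolve_left fun h => hea.ne h.2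
  rw [hπ, Ideal.span_singleton_pow, Ideal.mem_span_singleton] at h1 h2
  obtain ⟨w, hw⟩ := h1
  refine ⟨w, (isUnit_or_dvd_of_maximalIdeal_eq hπ w).resolve_right ?_, by rw [hw, mul_comm]⟩
  rintro ⟨z, rfl⟩
  exact h2 ⟨z, by rw [hw, pow_succ, mul_assoc]⟩

theorem HasParameters.cast_pow_eq_zero_iff (hR : HasParameters R a e f p)
    (hπ : IsUniformizer R π) (hea : e < a) (j : ℕ) : (p : R) ^ j = 0 ↔ a ≤ e * j := by
  obtain ⟨w, hw, h⟩ := hR.cast_eq_mul_pow hπ hea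
  rw [h, mul_pow, (hw.pow j).mul_right_eq_zero, ← pow_mul]
  exact ⟨hR.le_of_pow_eq_zero hπ, fun h => pow_eq_zero_of_le h (hR.pow_eq_zero hπ)⟩

theorem HasParameters.of_ringEquiv {R' : Type*} [CommRing R'] [IsLocalRing R']
    (hR : HasParameters R a e f p) (ρ : R ≃+* R') : HasParameters R' a e f p := by
  have hm : (maximalIdeal R).map ρ = maximalIdeal R' :=
    map_ringEquiv_maximalIdeal ρ
  have hpow (n : ℕ) : maximalIdeal R' ^ n = (maximalIdeal R ^ n).map ρ := by
    rw [Ideal.map_pow, hm]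
  have hmem (n : ℕ) : (p : R') ∈ maximalIdeal R' ^ n ↔ (p : R) ∈ maximalIdeal R ^ n := by
    rw [hpow, ← map_natCast ρ]
    exact Ideal.apply_mem_of_equiv_iff
  refine ⟨hR.prime, ?_, ?_, ?_⟩
  · rw [← hR.card_residueField]
    exact (Nat.card_congr (ResidueField.mapEquiv ρ).toEquiv).symm
  · convert hR.nilpotencyIndex using 2
    ext n
    rw [hpow]
    exact Ideal.map_eq_bot_iff_of_injective ρ.injective
  · rw [hmem, hmem]
    convert hR.ramificationIndex using 2
    rw [← map_natCast ρ, map_eq_zero_iff ρ ρ.injective]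

theorem HasParameters.unique {a' e' f' p' : ℕ} (hR : HasParameters R a e f p)
    (hR' : HasParameters R a' e' f' p') : a = a' ∧ e = e' ∧ f = f' ∧ p = p' := by
  have hcard := hR.card_residueField.symm.trans hR'.card_residueField
  obtain rfl : p = p' := by
    have h1 : p ∣ p' ^ f' := hcard ▸ dvd_pow_self p hR.f_ne_zero
    exact (Nat.prime_dvd_prime_iff_eq hR.prime hR'.prime).1 (hR.prime.dvd_of_dvd_pow h1)
  obtain rfl := hR.nilpotencyIndex.unique hR'.nilpotencyIndex
  refine ⟨rfl, ?_, Nat.pow_right_injective hR.prime.two_le hcard, rfl⟩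
  rcases hR.ramificationIndex with ⟨h, rfl⟩ | ⟨h1, h2⟩ <;>
    rcases hR'.ramificationIndex with ⟨h', rfl⟩ | ⟨h1', h2'⟩
  · rfl
  · exact absurd (h ▸ zero_mem _) h2'
  · exact absurd (h' ▸ zero_mem _) h2
  · refine le_antisymm ?_ ?_ <;> by_contra! hlt
    · exact h2' (Ideal.pow_le_pow_right hlt h1)
    · exact h2 (Ideal.pow_le_pow_right hlt h1')

end Parameters

/-! ### Existence and uniqueness of the coefficient ring -/

section CoefficientRing

theorem ringHom_aeval_int {A B : Type*} [CommRing A] [CommRing B] (φ : A →+* B) (x : A)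
    (P : ℤ[X]) : φ (aeval x P) = aeval (φ x) P :=
  (aeval_algHom_apply φ.toIntAlgHom x P).symm

variable {R : Type*} [CommRing R] {a e f p : ℕ} {π b : R} {h : ℤ[X]}

/-- The subring `ℤ[b]` of `R`. -/
noncomputable def intAdjoin (b : R) : Subring R := (aeval b : ℤ[X] →ₐ[ℤ] R).toRingHom.range

theorem mem_intAdjoin {x : R} : x ∈ intAdjoin b ↔ ∃ P : ℤ[X], aeval b P = x := Iff.rfl

theorem intAdjoin_le {S : Subring R} (hb : b ∈ S) : intAdjoin b ≤ S := by
  rintro _ ⟨P, rfl⟩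
  change aeval b P ∈ S
  rw [aeval_eq_sum_range]
  exact sum_mem fun i _ => zsmul_mem (pow_mem hb i) _

theorem isNilpotent_cast_subring (S : Subring R) (h : IsNilpotent (p : R)) :
    IsNilpotent (p : S) := by
  obtain ⟨n, hn⟩ := h
  exact ⟨n, Subtype.ext (by simpa using hn)⟩

variable [IsLocalRing R]

/-- Hensel lifting of a residual root, which is simple because finite fields are perfect. -/
theorem HasParameters.exists_root (hR : HasParameters R a e f p) (hh : IsInertPolynomial f p h) :
    ∃ b : R, aeval b h = 0 := by
  obtain ⟨β, hβ⟩ := hh.exists_root_of_card hR.prime hR.card_residueField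
  obtain ⟨x, rfl⟩ := residue_surjective β
  have hres := ringHom_aeval_int (residue R) x
  have h1 : IsNilpotent (aeval x h) :=
    hR.isNilpotent_of_mem (by rw [← residue_eq_zero_iff, hres, hβ])
  have h2 : IsUnit (aeval x (derivative h)) := by
    rw [← residue_ne_zero_iff_isUnit, hres]
    exact hh.aeval_derivative_ne_zero hR.prime hR.cast_residueField hβ
  obtain ⟨r, ⟨_, hr⟩, _⟩ := existsUnique_nilpotent_sub_and_aeval_eq_zero h1 h2
  exact ⟨r, hr⟩

theorem HasParameters.residue_comp_aeval_surjective (hR : HasParameters R a e f p)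
    (hh : IsInertPolynomial f p h) (hb : aeval b h = 0) (x : ResidueField R) :
    ∃ P : ℤ[X], residue R (aeval b P) = x := by
  have := hR.finite_residueField
  have hres := ringHom_aeval_int (residue R) b
  obtain ⟨P, hP⟩ := (hh.pow_le_card_and_surjective hR.prime hR.cast_residueField
    (β := residue R b) (by rw [← hres, hb, map_zero])).2 hR.card_residueField x
  exact ⟨P, (hres P).trans hP⟩

theorem HasParameters.isUnit_or_dvd_intAdjoin (hR : HasParameters R a e f p)
    (hh : IsInertPolynomial f p h) (hb : aeval b h = 0) (x : intAdjoin b) :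
    IsUnit x ∨ (p : intAdjoin b) ∣ x := by
  obtain ⟨x, P, rfl⟩ := x
  exact hh.isUnit_or_dvd hR.prime (isNilpotent_cast_subring _ hR.isNilpotent_cast)
    (aeval b : ℤ[X] →ₐ[ℤ] R).toRingHom.rangeRestrict (Subtype.ext hb) P

theorem HasParameters.isCoefficientRing_intAdjoin (hR : HasParameters R a e f p)
    (hh : IsInertPolynomial f p h) (hb : aeval b h = 0) :
    IsCoefficientRing R p (intAdjoin b) := by
  have hn := isNilpotent_cast_subring (intAdjoin b) hR.isNilpotent_cast
  have hd := hR.isUnit_or_dvd_intAdjoin hh hb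
  have hloc := isLocalRing_of_forall_isUnit_or_dvd hn hd
  have hmax := maximalIdeal_eq_span_of_forall_isUnit_or_dvd hn hd
  refine ⟨hloc, hmax, ?_, ?_⟩
  · rw [← hmax]
    refine ((maximalIdeal.isMaximal (intAdjoin b)).eq_of_le
      (Ideal.comap_ne_top _ (maximalIdeal.isMaximal R).ne_top) ?_).symm
    rw [hmax, Ideal.span_singleton_le_iff_mem, Ideal.mem_comap, map_natCast]
    exact hR.cast_mem
  · intro x
    obtain ⟨P, hP⟩ := hR.residue_comp_aeval_surjective hh hb x
    exact ⟨⟨aeval b P, P, rfl⟩, hP⟩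

theorem IsCoefficientRing.isUnit_or_dvd {S : Subring R} (hS : IsCoefficientRing R p S) (x : S) :
    IsUnit x ∨ (p : S) ∣ x :=
  have := hS.isLocalRing
  isUnit_or_dvd_of_maximalIdeal_eq hS.maximalIdeal_eq x

theorem IsCoefficientRing.dvd_of_mem {S : Subring R} (hS : IsCoefficientRing R p S) {x : S}
    (hx : (x : R) ∈ maximalIdeal R) : (p : S) ∣ x := by
  rw [← Ideal.mem_span_singleton, ← hS.comap_eq]
  exact hx

theorem IsCoefficientRing.exists_dvd_sub {S : Subring R} (hS : IsCoefficientRing R p S)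
    (hπ : IsUniformizer R π) (x : R) : ∃ s : S, π ∣ x - s := by
  obtain ⟨s, hs⟩ := hS.residue_surjective (residue R x)
  refine ⟨s, ?_⟩
  rw [← Ideal.mem_span_singleton, ← hπ, ← residue_eq_zero_iff, map_sub, sub_eq_zero]
  exact hs.symm

/-- Newton iteration can be run inside `S`, starting from an element with the same residue as `b`.
The root found there must be `b`, since in `R` the lift of a simple residual root is unique. -/
theorem IsCoefficientRing.mem_of_root (hR : HasParameters R a e f p) {S : Subring R}
    (hS : IsCoefficientRing R p S) (hh : IsInertPolynomial f p h) (hb : aeval b h = 0) :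
    b ∈ S := by
  have hres (P : ℤ[X]) (x : R) := ringHom_aeval_int (residue R) x P
  have hcoe (P : ℤ[X]) (x : S) : ((aeval x P : S) : R) = aeval (x : R) P :=
    ringHom_aeval_int S.subtype x P
  obtain ⟨x, hx⟩ := hS.residue_surjective (residue R b)
  replace hx : residue R (x : R) = residue R b := hx
  have hbar := hres h b
  rw [hb, map_zero] at hbar
  replace hbar := hbar.symm
  have hnilS {z : S} (hz : (z : R) ∈ maximalIdeal R) : IsNilpotent z := by
    obtain ⟨n, hn⟩ := hR.isNilpotent_of_mem hz
    exact ⟨n, Subtype.ext (by simpa using hn)⟩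
  have hmem : aeval (x : R) h ∈ maximalIdeal R := by
    rw [← residue_eq_zero_iff, hres, hx, hbar]
  have hder : IsUnit (aeval (x : R) (derivative h)) := by
    rw [← residue_ne_zero_iff_isUnit, hres, hx]
    exact hh.aeval_derivative_ne_zero hR.prime hR.cast_residueField hbar
  have h1 : IsNilpotent (aeval x h) := hnilS (by rw [hcoe]; exact hmem)
  have h2 : IsUnit (aeval x (derivative h)) := by
    refine (hS.isUnit_or_dvd _).resolve_right fun ⟨z, hz⟩ => ?_
    have h3 := congrArg (fun s : S => (s : R)) hz
    simp only [hcoe] at h3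
    rw [h3] at hder
    refine (mem_maximalIdeal _).1 ?_ hder
    simpa using Ideal.mul_mem_right _ _ hR.cast_mem
  obtain ⟨r, ⟨hr1, hr2⟩, _⟩ := existsUnique_nilpotent_sub_and_aeval_eq_zero h1 h2
  have huniq := (existsUnique_nilpotent_sub_and_aeval_eq_zero
    (hR.isNilpotent_of_mem hmem) hder).unique (y₁ := b) (y₂ := (r : R))
    ⟨hR.isNilpotent_of_mem (by rw [← residue_eq_zero_iff, map_sub, hx, sub_self]), hb⟩
    ⟨by simpa using hr1.map S.subtype, by rw [← hcoe, hr2]; rfl⟩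
  exact huniq ▸ r.2

theorem IsCoefficientRing.eq_intAdjoin (hR : HasParameters R a e f p) {S : Subring R}
    (hS : IsCoefficientRing R p S) (hh : IsInertPolynomial f p h) (hb : aeval b h = 0) :
    S = intAdjoin b := by
  have hbS := hS.mem_of_root hR hh hb
  refine le_antisymm (fun x hx => ?_) (intAdjoin_le hbS)
  have hp : (Subring.inclusion (intAdjoin_le hbS)) (p : intAdjoin b) = p := map_natCast _ _
  -- `ℤ[b]` and `S` have the same residue field and `p` generates the maximal ideal of `S`, so
  -- `p`-adic approximation makes the inclusion onto.
  obtain ⟨z, hz⟩ := surjective_of_forall_exists_dvd_sub (Subring.inclusion (intAdjoin_le hbS))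
    (y := (p : intAdjoin b)) (by rw [hp]; exact isNilpotent_cast_subring S hR.isNilpotent_cast)
    (fun c => by
      obtain ⟨s, hs⟩ := (hR.isCoefficientRing_intAdjoin hh hb).residue_surjective (residue R c)
      refine ⟨s, ?_⟩
      rw [hp]
      refine hS.dvd_of_mem ?_
      rw [← residue_eq_zero_iff]
      change residue R (c - s) = 0
      rw [map_sub, sub_eq_zero]
      exact hs.symm) ⟨x, hx⟩
  rw [← show (z : R) = x from congrArg Subtype.val hz]
  exact z.2

end CoefficientRing

/-! ### The dichotomy for Eisenstein quotients -/

section Eisenstein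

variable {A B : Type*} [CommRing A] [CommRing B] {e p : ℕ} {g : B[X]}

/-- Since `q X ^ e` is `p` times a unit, `q X` divides `p`. The dichotomy for constants relative to
`p` thus weakens to one relative to `q X`, and it extends to all of `A`. -/
theorem forall_isUnit_or_dvd_of_eisenstein (q : B[X] →+* A) (hq : Function.Surjective q)
    (hp : IsNilpotent (p : A)) (hc : ∀ c, IsUnit (q (C c)) ∨ (p : A) ∣ q (C c)) (hg : g.Monic)
    (hdeg : g.natDegree = e) (he : 0 < e) (hqg : q g = 0)
    (hdvd : ∀ i < e, (p : A) ∣ q (C (g.coeff i))) {d : A} (hd : IsUnit d)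
    (h0 : q (C (g.coeff 0)) = p * d) :
    IsNilpotent (q X) ∧ (∃ w, IsUnit w ∧ q X ^ e = p * w) ∧ ∀ x, IsUnit x ∨ q X ∣ x := by
  have hq' : eval₂RingHom (q.comp C) (q X) = q := by
    ext <;> simp
  have hz : g.eval₂ (q.comp C) (q X) = 0 := by
    rw [← coe_eval₂RingHom, hq', hqg]
  obtain ⟨hn, w, hw, h⟩ :=
    exists_isUnit_pow_eq_of_eval₂_eq_zero (q.comp C) hg hdeg he hz hdvd h0 hd hp
  refine ⟨hn, ⟨w, hw, h⟩, forall_isUnit_or_dvd_of_surjective (q.comp C) (by rwa [hq']) hn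
    fun c => (hc c).imp_right fun h1 => ?_⟩
  refine dvd_trans ?_ h1
  rw [← hw.dvd_mul_right, ← h]
  exact dvd_pow_self _ he.ne'

theorem isPEisenstein_iff (h1 : ¬ IsUnit (p : B)) : IsPEisenstein p e g ↔
    g.Monic ∧ g.natDegree = e ∧ (∀ i < e, (p : B) ∣ g.coeff i) ∧ ¬ (p : B) ^ 2 ∣ g.coeff 0 := by
  refine ⟨fun ⟨hm, hd, hE⟩ => ⟨hm, hd, fun i hi => ?_, ?_⟩, fun ⟨hm, hd, h2, h3⟩ => ⟨hm, hd, ?_⟩⟩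
  · exact Ideal.mem_span_singleton.1 (hE.mem (hd ▸ hi))
  · rw [← Ideal.mem_span_singleton, ← Ideal.span_singleton_pow]
    exact hE.notMem
  · refine ⟨?_, fun {i} hi => ?_, ?_⟩
    · rw [hm.leadingCoeff, Ideal.mem_span_singleton]
      exact fun h => h1 (isUnit_of_dvd_one h)
    · exact Ideal.mem_span_singleton.2 (h2 i (hd ▸ hi))
    · rwa [Ideal.span_singleton_pow, Ideal.mem_span_singleton]

end Eisenstein

/-! ### Eisenstein polynomials over the coefficient ring -/

section LocalPIR

variable {R : Type*} [CommRing R] [IsLocalRing R] {a e f p : ℕ} {π : R} {S : Subring R}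
  {g : S[X]}

theorem HasParameters.not_isUnit_cast (hR : HasParameters R a e f p) (S : Subring R) :
    ¬ IsUnit (p : S) :=
  (isNilpotent_cast_subring S hR.isNilpotent_cast).not_isUnit

theorem IsCoefficientRing.coeff_zero_of_isPEisenstein (hR : HasParameters R a e f p)
    (hS : IsCoefficientRing R p S) (hg : IsPEisenstein p e g) :
    ∃ d, IsUnit d ∧ g.coeff 0 = p * d := by
  obtain ⟨-, -, h1, h2⟩ :=
    (isPEisenstein_iff (hR.not_isUnit_cast S)).1 hg
  obtain ⟨d, hd⟩ := h1 0 hR.e_pos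
  refine ⟨d, (hS.isUnit_or_dvd d).resolve_right ?_, hd⟩
  rintro ⟨z, rfl⟩
  exact h2 ⟨z, by rw [hd, pow_two, mul_assoc]⟩

theorem IsCoefficientRing.forall_isUnit_or_dvd (hR : HasParameters R a e f p)
    (hS : IsCoefficientRing R p S) (hg : IsPEisenstein p e g) {A : Type*} [CommRing A]
    (q : S[X] →+* A) (hq : Function.Surjective q) (hqg : q g = 0) :
    IsNilpotent (q X) ∧ (∃ w, IsUnit w ∧ q X ^ e = p * w) ∧ ∀ x, IsUnit x ∨ q X ∣ x := by
  obtain ⟨d, hd, h0⟩ := hS.coeff_zero_of_isPEisenstein hR hg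
  have hcast : q (C (p : S)) = p := by simp
  have hmap {x z : S} (h : x ∣ z) : q (C x) ∣ q (C z) := map_dvd q (map_dvd C h)
  refine forall_isUnit_or_dvd_of_eisenstein (d := q (C d)) q hq ?_ (fun c => ?_) hg.1 hg.2.1
    hR.e_pos hqg (fun i hi => ?_) ((hd.map C).map q) (by rw [h0]; simp)
  · rw [← hcast]
    exact ((isNilpotent_cast_subring S hR.isNilpotent_cast).map C).map q
  · rw [← hcast]
    exact (hS.isUnit_or_dvd c).imp (fun h => (h.map C).map q) hmap
  · rw [← hcast]
    exact hmap (((isPEisenstein_iff (hR.not_isUnit_cast S)).1 hg).2.2.1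
      i hi)

theorem IsCoefficientRing.isUniformizer_of_eval₂_eq_zero (hR : HasParameters R a e f p)
    (hπ : IsUniformizer R π) (hea : e < a) (hS : IsCoefficientRing R p S)
    (hg : IsPEisenstein p e g) {u : R} (hu : g.eval₂ S.subtype u = 0) : IsUniformizer R u := by
  obtain ⟨d, hd, h0⟩ := hS.coeff_zero_of_isPEisenstein hR hg
  obtain ⟨hn, w, hw, h⟩ := exists_isUnit_pow_eq_of_eval₂_eq_zero (ϖ := (p : R)) S.subtype hg.1
    hg.2.1 hR.e_pos hu (fun i hi => by
      have := map_dvd S.subtype (((isPEisenstein_iff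
        (hR.not_isUnit_cast S)).1 hg).2.2.1 i hi)
      rwa [map_natCast] at this) (by rw [h0, map_mul, map_natCast]) (hd.map S.subtype)
    hR.isNilpotent_cast
  obtain ⟨v, hv, hpv⟩ := hR.cast_eq_mul_pow hπ hea
  have hdvd := isUnit_or_dvd_of_maximalIdeal_eq hπ
  obtain ⟨z, rfl⟩ := (hdvd u).resolve_left hn.not_isUnit
  have hz : IsUnit z := by
    refine (hdvd z).resolve_right ?_
    rintro ⟨t, rfl⟩
    -- Were the zero divisible by `π ^ 2`, its `e`-th power would lie in `(π ^ (2 * e))`, whereas it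
    -- equals `p * w`, a unit times `π ^ e`. This forces `π ^ e = 0`, against `e < a`.
    have h1 : π ^ e * (v * w - π ^ e * t ^ e) = 0 := by
      rw [hpv] at h
      rw [mul_pow, mul_pow] at h
      linear_combination -h
    have h2 : IsUnit (v * w - π ^ e * t ^ e) := by
      rw [sub_eq_add_neg]
      refine IsNilpotent.isUnit_add_left_of_commute ?_ (hv.mul hw) (Commute.all _ _)
      exact ((Commute.all _ _).isNilpotent_mul_right
        ((hR.isNilpotent_uniformizer hπ).pow_of_pos hR.e_pos.ne')).neg
    exact hea.not_ge (hR.le_of_pow_eq_zero hπ (h2.mul_left_eq_zero.1 h1))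
  rw [IsUniformizer, hπ, Ideal.span_singleton_mul_right_unit hz]

theorem IsCoefficientRing.exists_sum_add (hS : IsCoefficientRing R p S) (hπ : IsUniformizer R π)
    (x : R) (n : ℕ) :
    ∃ (s : ℕ → S) (z : R), x = ∑ i ∈ Finset.range n, s i * π ^ i + π ^ n * z := by
  induction n with
  | zero => exact ⟨0, x, by simp⟩
  | succ n ih =>
    obtain ⟨s, z, rfl⟩ := ih
    obtain ⟨c, w, hw⟩ := hS.exists_dvd_sub hπ z
    refine ⟨Function.update s n c, w, ?_⟩
    have : ∑ i ∈ Finset.range n, (Function.update s n c i : R) * π ^ i =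
        ∑ i ∈ Finset.range n, s i * π ^ i := Finset.sum_congr rfl fun i hi => by
      rw [Function.update_of_ne (Finset.mem_range.1 hi).ne]
    rw [Finset.sum_range_succ, Function.update_self, this]
    linear_combination π ^ n * hw

/-- After `e` digits of a `π`-adic expansion the remainder is a multiple of `π ^ e = v * p`.
Iterating produces remainders divisible by rising powers of the nilpotent `p`. -/
theorem IsCoefficientRing.exists_sum (hR : HasParameters R a e f p) (hπ : IsUniformizer R π)
    (hea : e < a) (hS : IsCoefficientRing R p S) (x : R) :
    ∃ s : ℕ → S, x = ∑ i ∈ Finset.range e, s i * π ^ i := by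
  obtain ⟨w, hw, hpw⟩ := hR.cast_eq_mul_pow hπ hea
  obtain ⟨v, hv⟩ := hw.exists_left_inv
  have key : ∀ N : ℕ, ∃ (s : ℕ → S) (z : R),
      x = ∑ i ∈ Finset.range e, s i * π ^ i + (p : R) ^ N * z := by
    intro N
    induction N with
    | zero => exact ⟨0, x, by simp⟩
    | succ N ih =>
      obtain ⟨s, z, hz⟩ := ih
      obtain ⟨t, z', rfl⟩ := hS.exists_sum_add hπ z e
      refine ⟨fun i => s i + p ^ N * t i, v * z', ?_⟩
      have : ∑ i ∈ Finset.range e, ((s i + p ^ N * t i : S) : R) * π ^ i =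
          ∑ i ∈ Finset.range e, s i * π ^ i +
            (p : R) ^ N * ∑ i ∈ Finset.range e, t i * π ^ i := by
        rw [Finset.mul_sum, ← Finset.sum_add_distrib]
        refine Finset.sum_congr rfl fun i _ => ?_
        push_cast
        ring
      rw [hz, this, pow_succ]
      linear_combination (-(p : R) ^ N * π ^ e * z') * hv - (p : R) ^ N * v * z' * hpw
  obtain ⟨N, hN⟩ := hR.isNilpotent_cast
  obtain ⟨s, z, h⟩ := key N
  exact ⟨s, by rw [h, hN]; simp⟩

theorem IsCoefficientRing.exists_isPEisenstein (hR : HasParameters R a e f p)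
    (hπ : IsUniformizer R π) (hea : e < a) (hS : IsCoefficientRing R p S) :
    ∃ g : S[X], IsPEisenstein p e g ∧ g.eval₂ S.subtype π = 0 := by
  obtain ⟨w, hw, hpw⟩ := hR.cast_eq_mul_pow hπ hea
  obtain ⟨v, hv⟩ := hw.exists_left_inv
  -- The equation to encode is `π ^ e + p * (-v) = 0`, so the lower coefficients of `g` are `p`
  -- times the coordinates of `-v`.
  obtain ⟨s, hs⟩ := hS.exists_sum hR hπ hea (-v)
  have hp0 : (p : S) ≠ 0 := fun h => by
    have h1 : (p : R) ^ 1 = 0 := by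
      rw [pow_one]; simpa using congrArg S.subtype h
    rw [hR.cast_pow_eq_zero_iff hπ hea] at h1
    omega
  have hs0 : IsUnit (s 0) := by
    refine (hS.isUnit_or_dvd _).resolve_right fun h => ?_
    have h1 : IsUnit (-v) := IsUnit.neg (IsUnit.of_mul_eq_one w hv)
    obtain ⟨n, rfl⟩ : ∃ n, e = n + 1 := ⟨e - 1, by have := hR.e_pos; omega⟩
    rw [hs, Finset.sum_range_succ', pow_zero, mul_one] at h1
    refine (mem_maximalIdeal _).1 (Ideal.add_mem _ (sum_mem fun i _ => ?_) ?_) h1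
    · rw [hπ, pow_succ]
      exact Ideal.mul_mem_left _ _ (Ideal.mul_mem_left _ _ (Ideal.mem_span_singleton_self π))
    · obtain ⟨t, ht⟩ := h
      rw [ht]
      simpa using Ideal.mul_mem_right _ _ hR.cast_mem
  have := (isNilpotent_cast_subring S hR.isNilpotent_cast)
  refine ⟨monicOfCoeff e fun i => p * s i, (isPEisenstein_iff (hR.not_isUnit_cast S)).2 ⟨monic_monicOfCoeff _ _,
      natDegree_monicOfCoeff _ _, fun i hi => ?_, ?_⟩, ?_⟩
  · rw [coeff_monicOfCoeff _ hi]
    exact dvd_mul_right _ _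
  · rw [coeff_monicOfCoeff _ hR.e_pos]
    rintro ⟨t, ht⟩
    -- Cancelling `p` is not allowed in `S`; instead the cofactor is a unit, which would give `p =
    -- 0` in `S`, excluded by `e < a`.
    have h1 : (p : S) * (s 0 + -(p * t)) = 0 := by linear_combination ht
    have h2 : IsUnit (s 0 + -(p * t)) :=
      ((Commute.all _ _).isNilpotent_mul_right this).neg.isUnit_add_left_of_commute hs0
        (Commute.all _ _)
    exact hp0 (h2.mul_left_eq_zero.1 h1)
  · rw [eval₂_monicOfCoeff]
    have : ∑ i ∈ Finset.range e, S.subtype (p * s i) * π ^ i = p * -v := by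
      rw [hs, Finset.mul_sum]
      refine Finset.sum_congr rfl fun i _ => ?_
      rw [map_mul, map_natCast, mul_assoc]
      rfl
    rw [this]
    linear_combination -π ^ e * hv - v * hpw

/-- Stated for an arbitrary quotient map `q` so as to serve both `S[Y] / (Y ^ a, g)` and the
two-step quotient of `AdjoinRoot g`. -/
theorem IsCoefficientRing.bijective_lift (hR : HasParameters R a e f p)
    (hπ : IsUniformizer R π) (hS : IsCoefficientRing R p S) (hg : IsPEisenstein p e g)
    {A : Type*} [CommRing A] (q : S[X] →+* A) (hq : Function.Surjective q) (hqg : q g = 0)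
    (hqa : q X ^ a = 0) (φ : A →+* R) (hφ : φ.comp q = eval₂RingHom S.subtype π) :
    Function.Bijective φ := by
  have hX : φ (q X) = π := by simpa using congrArg (fun ψ => ψ X) hφ
  refine bijective_of_forall_exists_dvd_sub φ hqa (hS.forall_isUnit_or_dvd hR hg q hq hqg).2.2
    (fun b => ?_) fun j hj => hR.le_of_pow_eq_zero hπ (by rwa [hX] at hj)
  obtain ⟨s, hs⟩ := hS.exists_dvd_sub hπ b
  refine ⟨q (C s), ?_⟩
  have hs' : φ (q (C s)) = s := by simpa using congrArg (fun ψ => ψ (C s)) hφ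
  rwa [hX, hs']

theorem IsCoefficientRing.nonempty_equiv_quotient_of_le (hR : HasParameters R a e f p)
    (hπ : IsUniformizer R π) (hS : IsCoefficientRing R p S) (hg : IsPEisenstein p e g)
    {J : Ideal S[X]} (hJ : J ≤ RingHom.ker (eval₂RingHom S.subtype π)) (hgJ : g ∈ J)
    (hXJ : X ^ a ∈ J) : Nonempty (R ≃+* S[X] ⧸ J) := by
  have hX0 : Ideal.Quotient.mk J X ^ a = 0 := by
    rw [← map_pow]
    exact Ideal.Quotient.eq_zero_iff_mem.2 hXJ
  have hφ : (Ideal.Quotient.lift J (eval₂RingHom S.subtype π) fun x hx => hJ hx).comp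
      (Ideal.Quotient.mk J) = eval₂RingHom S.subtype π := Ideal.Quotient.lift_comp_mk _ _ _
  exact ⟨(RingEquiv.ofBijective _ (hS.bijective_lift (A := S[X] ⧸ J) hR hπ hg
    (Ideal.Quotient.mk J)
    Ideal.Quotient.mk_surjective (Ideal.Quotient.eq_zero_iff_mem.2 hgJ) hX0 _ hφ)).symm⟩

theorem IsCoefficientRing.nonempty_equiv_quotient (hR : HasParameters R a e f p)
    (hπ : IsUniformizer R π) (hS : IsCoefficientRing R p S) (hg : IsPEisenstein p e g)
    (hgπ : g.eval₂ S.subtype π = 0) : Nonempty (R ≃+* S[X] ⧸ Ideal.span {X ^ a, g}) := by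
  refine hS.nonempty_equiv_quotient_of_le hR hπ hg ?_ (Ideal.subset_span (Or.inr rfl))
    (Ideal.subset_span (Or.inl rfl))
  rw [Ideal.span_le, Set.insert_subset_iff, Set.singleton_subset_iff]
  refine ⟨?_, hgπ⟩
  rw [SetLike.mem_coe, RingHom.mem_ker, coe_eval₂RingHom, eval₂_X_pow, hR.pow_eq_zero hπ]

theorem IsCoefficientRing.nonempty_equiv_adjoinRoot_quotient (hR : HasParameters R a e f p)
    (hπ : IsUniformizer R π) (hS : IsCoefficientRing R p S) (hg : IsPEisenstein p e g)
    (hgπ : g.eval₂ S.subtype π = 0) :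
    Nonempty (R ≃+* AdjoinRoot g ⧸ Ideal.span {AdjoinRoot.root g ^ a}) := by
  have hmem : ∀ x ∈ Ideal.span {AdjoinRoot.root g ^ a}, AdjoinRoot.lift S.subtype π hgπ x = 0 := by
    change Ideal.span {AdjoinRoot.root g ^ a} ≤ RingHom.ker (AdjoinRoot.lift S.subtype π hgπ)
    rw [Ideal.span_singleton_le_iff_mem, RingHom.mem_ker, map_pow, AdjoinRoot.lift_root,
      hR.pow_eq_zero hπ]
  refine ⟨(RingEquiv.ofBijective (Ideal.Quotient.lift _ _ hmem)
    (hS.bijective_lift hR hπ hg ((Ideal.Quotient.mk _).comp (AdjoinRoot.mk g))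
      (Ideal.Quotient.mk_surjective.comp AdjoinRoot.mk_surjective) ?_ ?_ _ ?_)).symm⟩
  · rw [RingHom.comp_apply, AdjoinRoot.mk_self, map_zero]
  · rw [← map_pow, RingHom.comp_apply, map_pow]
    exact Ideal.Quotient.eq_zero_iff_mem.2 (Ideal.mem_span_singleton_self _)
  · refine RingHom.ext fun x => ?_
    simp

theorem card_residueField_of_surjective {A k : Type*} [CommRing A] [IsLocalRing A] [Field k]
    (ψ : A →+* k) (hψ : Function.Surjective ψ) :
    Nat.card (ResidueField A) = Nat.card k := by
  have h : RingHom.ker ψ = maximalIdeal A :=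
    IsLocalRing.eq_maximalIdeal (RingHom.ker_isMaximal_of_surjective ψ hψ)
  exact Nat.card_congr
    ((Ideal.quotEquivOfEq h.symm).trans (RingHom.quotientKerEquivOfSurjective hψ)).toEquiv

theorem IsCoefficientRing.isFiniteLocalPIR_adjoinRoot [Finite R] (hR : HasParameters R a e f p)
    (hπ : IsUniformizer R π) (hea : e < a) (hS : IsCoefficientRing R p S)
    (hg : IsPEisenstein p e g) (hgπ : g.eval₂ S.subtype π = 0) :
    IsFiniteLocalPIR (AdjoinRoot g) ((a ⌈/⌉ e) * e) e f p := by
  have he := hR.e_pos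
  obtain ⟨hn, ⟨w, hw, hew⟩, hA⟩ := hS.forall_isUnit_or_dvd hR hg (AdjoinRoot.mk g)
    AdjoinRoot.mk_surjective AdjoinRoot.mk_self
  rw [AdjoinRoot.mk_X] at hn hew hA
  set y := AdjoinRoot.root g
  set ψ := AdjoinRoot.lift S.subtype π hgπ
  have : Nontrivial (AdjoinRoot g) := ψ.domain_nontrivial
  have hloc := isLocalRing_of_forall_isUnit_or_dvd hn hA
  have hmax := maximalIdeal_eq_span_of_forall_isUnit_or_dvd hn hA
  have hfin : Finite (AdjoinRoot g) := by
    have := hg.1.finite_adjoinRoot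
    exact Module.finite_of_finite S
  have hceil (j : ℕ) : a ⌈/⌉ e ≤ j ↔ a ≤ e * j := by
    rw [ceilDiv_le_iff_le_mul he]
  have hpS (j : ℕ) : (p : S) ^ j = 0 ↔ a ⌈/⌉ e ≤ j := by
    rw [hceil, ← hR.cast_pow_eq_zero_iff hπ hea, ← S.subtype_injective.eq_iff]
    simp
  have hpow : y ^ ((a ⌈/⌉ e) * e) = 0 := by
    have h1 : (p : AdjoinRoot g) ^ (a ⌈/⌉ e) = 0 := by
      rw [← map_natCast (AdjoinRoot.of g), ← map_pow, (hpS _).2 le_rfl, map_zero]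
    rw [mul_comm, pow_mul, hew, mul_pow, h1, zero_mul]
  have hmin (n : ℕ) (hn : y ^ n = 0) : (a ⌈/⌉ e) * e ≤ n := by
    by_contra! hlt
    obtain ⟨m, hm⟩ : ∃ m, a ⌈/⌉ e = m + 1 := ⟨a ⌈/⌉ e - 1, by
      have : a ⌈/⌉ e ≠ 0 := fun h => by rw [h] at hlt; simp at hlt
      omega⟩
    rw [hm] at hlt
    -- With `a₀ = m + 1`, this exponent is `a₀ * e - 1`. Up to a unit the power is `p ^ m * y ^ (e -
    -- 1)`, which is nonzero: `p ^ m ≠ 0` in `S`, and the representative has degree below that of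
    -- the monic `g`.
    have h1 : y ^ (e * m + (e - 1)) = 0 := by
      refine pow_eq_zero_of_le ?_ hn
      have : (m + 1) * e = e * m + e := by ring
      omega
    rw [pow_add, pow_mul, hew, mul_pow, mul_assoc, mul_comm (w ^ m), ← mul_assoc,
      (hw.pow m).mul_left_eq_zero] at h1
    have h2 : AdjoinRoot.mk g (C ((p : S) ^ m) * X ^ (e - 1)) = 0 := by
      simpa using h1
    have hpm : (p : S) ^ m ≠ 0 := by rw [Ne, hpS]; omega
    refine AdjoinRoot.mk_ne_zero_of_natDegree_lt hg.1 ?_ ?_ h2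
    · rwa [Ne, C_mul_X_pow_eq_monomial, monomial_eq_zero_iff]
    · rw [natDegree_C_mul_X_pow _ _ hpm, hg.2.1]
      omega
  obtain ⟨v, hv⟩ := hw.exists_right_inv
  have hpy : (p : AdjoinRoot g) = y ^ e * v := by
    rw [hew, mul_assoc, hv, mul_one]
  refine ⟨hloc, hfin, isPrincipalIdealRing_of_forall_isUnit_or_dvd hn hA, hR.prime, ?_, ⟨?_, ?_⟩,
    Or.inr ⟨?_, ?_⟩⟩
  · rw [← hR.card_residueField]
    refine card_residueField_of_surjective ((residue R).comp ψ) fun x => ?_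
    obtain ⟨s, hs⟩ := hS.residue_surjective x
    refine ⟨AdjoinRoot.of g s, ?_⟩
    rw [RingHom.comp_apply, AdjoinRoot.lift_of]
    exact hs
  · rw [Set.mem_ofPred_eq, hmax, Ideal.span_singleton_pow, hpow, Ideal.span_singleton_eq_bot]
  · intro n hn
    rw [Set.mem_ofPred_eq, hmax, Ideal.span_singleton_pow, Ideal.span_singleton_eq_bot] at hn
    exact hmin n hn
  · rw [hmax, Ideal.span_singleton_pow, Ideal.mem_span_singleton]
    exact ⟨v, hpy⟩
  · rw [hmax, Ideal.span_singleton_pow, Ideal.mem_span_singleton]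
    rintro ⟨z, hz⟩
    have h1 : y ^ e * (v + -(y * z)) = 0 := by
      rw [hpy, pow_succ] at hz
      linear_combination hz
    have h2 : IsUnit (v + -(y * z)) :=
      ((Commute.all _ _).isNilpotent_mul_right hn).neg.isUnit_add_left_of_commute
        (IsUnit.of_mul_eq_one w (by rw [mul_comm, hv])) (Commute.all _ _)
    -- If `p` lay in `(y ^ (e + 1))`, then `y ^ e = 0`, whence `a₀ ≤ 1` and `a ≤ e`.
    have h3 := hmin e (h2.mul_left_eq_zero.1 h1)
    have h4 : a ⌈/⌉ e ≤ 1 := by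
      by_contra! h
      nlinarith
    rw [hceil] at h4
    omega

end LocalPIR

/-! ### The signature determines the ring -/

section Signature

variable {R R' : Type*} [CommRing R] [CommRing R'] {e p : ℕ}

theorem IsPEisenstein.not_isUnit {A : Type*} [CommRing A] {q : A[X]} (hq : IsPEisenstein p e q) :
    ¬ IsUnit (p : A) := fun h => hq.2.2.leading (by
  rw [Ideal.span_singleton_eq_top.2 h]
  exact Submodule.mem_top)

theorem IsPEisenstein.map_ringEquiv {A B : Type*} [CommRing A] [CommRing B] {q : A[X]}
    (hq : IsPEisenstein p e q) (σ : A ≃+* B) : IsPEisenstein p e (q.map (σ : A →+* B)) := by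
  have hp : (σ : A →+* B) (p : A) = p := map_natCast _ _
  have hdvd {x z : A} : (σ : A →+* B) x ∣ (σ : A →+* B) z ↔ x ∣ z := map_dvd_iff σ
  have hu : ¬ IsUnit (p : B) := by
    rw [← hp]
    exact fun h => hq.not_isUnit ((MulEquiv.isUnit_map σ).1 h)
  obtain ⟨h1, h2, h3, h4⟩ := (isPEisenstein_iff hq.not_isUnit).1 hq
  refine (isPEisenstein_iff hu).2 ⟨h1.map _, ?_, fun i hi => ?_, ?_⟩
  · rw [natDegree_map_eq_of_injective σ.injective, h2]
  · rw [coeff_map, ← hp, hdvd]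
    exact h3 i hi
  · rwa [coeff_map, ← hp, ← map_pow, hdvd]

theorem map_mem_eisensteinWithZero {S : Subring R} {S' : Subring R'} (ρ : R ≃+* R')
    (σ : S ≃+* S') (hσ : ∀ s, (σ s : R') = ρ s) {q : S[X]} (hq : q ∈ eisensteinWithZero S p e) :
    q.map (σ : S →+* S') ∈ eisensteinWithZero S' p e := by
  obtain ⟨h1, u, hu⟩ := hq
  refine ⟨h1.map_ringEquiv σ, ρ u, ?_⟩
  have hcomp : S'.subtype.comp (σ : S →+* S') = (ρ : R →+* R').comp S.subtype :=
    RingHom.ext hσ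
  rw [eval₂_map, hcomp, ← RingEquiv.coe_toRingHom, ← hom_eval₂, hu, map_zero]

theorem image_eisensteinWithZero {S : Subring R} {S' : Subring R'} (ρ : R ≃+* R')
    (σ : S ≃+* S') (hσ : ∀ s, (σ s : R') = ρ s) :
    Polynomial.map (σ : S →+* S') '' eisensteinWithZero S p e = eisensteinWithZero S' p e := by
  refine subset_antisymm ?_ fun q hq => ?_
  · rintro _ ⟨q, hq, rfl⟩
    exact map_mem_eisensteinWithZero ρ σ hσ hq
  · refine ⟨_, map_mem_eisensteinWithZero ρ.symm σ.symm (fun s => ?_) hq, ?_⟩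
    · rw [RingEquiv.eq_symm_apply, ← hσ, RingEquiv.apply_symm_apply]
    · rw [Polynomial.map_map, RingEquiv.comp_symm, Polynomial.map_id]

theorem nonempty_ringEquiv_iff [IsLocalRing R] [IsLocalRing R'] {a f a' e' f' p' : ℕ} {π : R}
    {π' : R'} (hR : HasParameters R a e f p) (hR' : HasParameters R' a' e' f' p')
    (hπ : IsUniformizer R π) (hπ' : IsUniformizer R' π') (hea : e < a) {S : Subring R}
    (hS : IsCoefficientRing R p S) {S' : Subring R'} (hS' : IsCoefficientRing R' p' S') :
    Nonempty (R ≃+* R') ↔ a = a' ∧ e = e' ∧ f = f' ∧ p = p' ∧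
      ∃ σ : S ≃+* S', Polynomial.map (σ : S →+* S') '' eisensteinWithZero S p e =
        eisensteinWithZero S' p' e' := by
  constructor
  · rintro ⟨ρ⟩
    obtain ⟨rfl, rfl, rfl, rfl⟩ := (hR.of_ringEquiv ρ).unique hR'
    refine ⟨rfl, rfl, rfl, rfl, ?_⟩
    obtain ⟨h, hh⟩ := exists_isInertPolynomial hR.prime hR.f_ne_zero
    obtain ⟨b, hb⟩ := hR.exists_root hh
    have hb' : aeval (ρ b) h = 0 := by
      have := ringHom_aeval_int (ρ : R →+* R') b h
      rw [hb, map_zero] at this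
      exact this.symm
    -- The coefficient rings are `ℤ[b]` and `ℤ[ρ b]`, so `ρ` restricts to an isomorphism between
    -- them.
    obtain rfl : S' = S.map (ρ : R →+* R') := by
      rw [hS'.eq_intAdjoin hR' hh hb', hS.eq_intAdjoin hR hh hb]
      ext x
      rw [Subring.mem_map, mem_intAdjoin]
      constructor
      · rintro ⟨P, rfl⟩
        exact ⟨aeval b P, ⟨P, rfl⟩, ringHom_aeval_int (ρ : R →+* R') b P⟩
      · rintro ⟨_, ⟨P, rfl⟩, rfl⟩
        exact ⟨P, (ringHom_aeval_int (ρ : R →+* R') b P).symm⟩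
    exact ⟨ρ.subringMap, image_eisensteinWithZero ρ _ fun s => rfl⟩
  · rintro ⟨rfl, rfl, rfl, rfl, σ, hσ⟩
    obtain ⟨g, hg, hgπ⟩ := hS.exists_isPEisenstein hR hπ hea
    obtain ⟨hg', u, hu⟩ : g.map (σ : S →+* S') ∈ eisensteinWithZero S' p e :=
      hσ ▸ Set.mem_image_of_mem _ ⟨hg, π, hgπ⟩
    obtain ⟨i⟩ := hS.nonempty_equiv_quotient hR hπ hg hgπ
    -- The zero `u` of the transported polynomial need not be `π'`, but it is a uniformizer, so it
    -- yields a presentation of `R'` just as well.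
    obtain ⟨j⟩ := hS'.nonempty_equiv_quotient hR'
      (hS'.isUniformizer_of_eval₂_eq_zero hR' hπ' hea hg' hu) hg' hu
    refine ⟨i.trans ((Ideal.quotientEquiv _ _ (Polynomial.mapEquiv σ) ?_).trans j.symm)⟩
    rw [Ideal.map_span, Set.image_insert_eq, Set.image_singleton]
    congr 3
    simp

end Signature

/-! ### The case `e = a` -/

section Equicharacteristic

variable {R : Type*} [CommRing R] [IsLocalRing R] {a f p : ℕ} {π : R}

theorem HasParameters.nonempty_equiv_quotient_X_pow (hR : HasParameters R a a f p)
    (hπ : IsUniformizer R π) :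
    Nonempty (R ≃+* (ResidueField R)[X] ⧸ Ideal.span {(X : (ResidueField R)[X]) ^ a}) := by
  obtain ⟨h, hh⟩ := exists_isInertPolynomial hR.prime hR.f_ne_zero
  obtain ⟨b, hb⟩ := hR.exists_root hh
  have hS := hR.isCoefficientRing_intAdjoin hh hb
  set S := intAdjoin b
  have hp0 : (p : S) = 0 := Subtype.ext (by simpa using hR.cast_eq_zero)
  -- As `p = 0`, the maximal ideal `p S` vanishes: `S` is a copy of the residue field inside `R`.
  have hinj : Function.Injective ((residue R).comp S.subtype) := by
    rw [injective_iff_map_eq_zero]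
    intro s hs
    have := hS.dvd_of_mem (x := s) (by rw [← residue_eq_zero_iff]; exact hs)
    rwa [hp0, zero_dvd_iff] at this
  let τ : S ≃+* ResidueField R := RingEquiv.ofBijective _ ⟨hinj, hS.residue_surjective⟩
  let φ₀ : (ResidueField R)[X] →+* R :=
    eval₂RingHom (S.subtype.comp (τ.symm : ResidueField R →+* S)) π
  let J : Ideal (ResidueField R)[X] := Ideal.span {X ^ a}
  have hJ : ∀ x ∈ J, φ₀ x = 0 := by
    change J ≤ RingHom.ker φ₀
    rw [Ideal.span_singleton_le_iff_mem, RingHom.mem_ker, coe_eval₂RingHom, eval₂_X_pow,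
      hR.pow_eq_zero hπ]
  let q := Ideal.Quotient.mk J
  have hqa : q X ^ a = 0 := by
    rw [← map_pow]
    exact Ideal.Quotient.eq_zero_iff_mem.2 (Ideal.mem_span_singleton_self _)
  have hφ (x : (ResidueField R)[X]) : Ideal.Quotient.lift J φ₀ hJ (q x) = φ₀ x :=
    Ideal.Quotient.lift_mk _ _ _
  have hφX : Ideal.Quotient.lift J φ₀ hJ (q X) = π := by
    rw [hφ]
    exact eval₂_X _ _
  have hq' : eval₂RingHom (q.comp C) (q X) = q := by
    ext <;> simp
  have hb : Function.Bijective (Ideal.Quotient.lift J φ₀ hJ) := by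
    refine bijective_of_forall_exists_dvd_sub _ hqa
      (forall_isUnit_or_dvd_of_surjective (q.comp C)
        (by rw [hq']; exact Ideal.Quotient.mk_surjective) ⟨a, hqa⟩ fun c => ?_) (fun r => ?_)
      fun j hj => hR.le_of_pow_eq_zero hπ (by rwa [hφX] at hj)
    · rcases eq_or_ne c 0 with rfl | hc
      · exact Or.inr (by simp)
      · exact Or.inl (hc.isUnit.map _)
    · obtain ⟨s, hs⟩ := hS.exists_dvd_sub hπ r
      refine ⟨q (C (τ s)), ?_⟩
      rw [hφX, hφ]
      simpa [φ₀] using hs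
  exact ⟨(RingEquiv.ofBijective _ hb).symm⟩

theorem HasParameters.nonempty_ringEquiv_of_eq {R' : Type*} [CommRing R'] [IsLocalRing R']
    {π' : R'} (hR : HasParameters R a a f p) (hπ : IsUniformizer R π)
    (hR' : HasParameters R' a a f p) (hπ' : IsUniformizer R' π') : Nonempty (R ≃+* R') := by
  obtain ⟨i⟩ := hR.nonempty_equiv_quotient_X_pow hπ
  obtain ⟨j⟩ := hR'.nonempty_equiv_quotient_X_pow hπ'
  have := hR.finite_residueField
  have := hR'.finite_residueField
  have := Fintype.ofFinite (ResidueField R)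
  have := Fintype.ofFinite (ResidueField R')
  let κ : ResidueField R ≃+* ResidueField R' := FiniteField.ringEquivOfCardEq (by
    rw [← Nat.card_eq_fintype_card, ← Nat.card_eq_fintype_card, hR.card_residueField,
      hR'.card_residueField])
  refine ⟨i.trans ((Ideal.quotientEquiv _ _ (Polynomial.mapEquiv κ) ?_).trans j.symm)⟩
  rw [Ideal.map_span, Set.image_singleton]
  simp

end Equicharacteristic

/-! ### Integer lifts and the presentation over `ℤ[X][Y]` -/

section Presentation

variable {a e f p : ℕ} {h : ℤ[X]} {G : ℤ[X][X]}

/-- `ℤ[X] / (h)` has no `p`-torsion, because `h` is nonzero in the domain `𝔽_p[X]`. -/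
theorem IsInertPolynomial.exists_eq_of_cast_mul (hp : p.Prime) (hh : IsInertPolynomial f p h)
    {P r : ℤ[X]} (hP : p * P = h * r) : ∃ r', P = h * r' := by
  have : Fact p.Prime := ⟨hp⟩
  have h1 : r.map (Int.castRingHom (ZMod p)) = 0 := by
    have := congrArg (Polynomial.map (Int.castRingHom (ZMod p))) hP
    simp only [Polynomial.map_mul, Polynomial.map_natCast, CharP.cast_eq_zero, zero_mul] at this
    exact (mul_eq_zero.1 this.symm).resolve_left hh.2.2.ne_zero
  obtain ⟨r', rfl⟩ := exists_eq_C_mul_of_map_eq_zero h1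
  refine ⟨r', mul_left_cancel₀ (Nat.cast_ne_zero.2 hp.ne_zero : (p : ℤ[X]) ≠ 0) ?_⟩
  linear_combination hP

/-- The Eisenstein condition over `ℤ[X] / (h)` becomes identities in `ℤ[X]`, usable under any
homomorphism that kills `h`. As `D ∉ (p, h)`, its image is a unit wherever `p` is moreover
nilpotent. -/
theorem exists_coeff_eq_of_isPEisenstein_map (he : 0 < e)
    (hE : IsPEisenstein p e (G.map (AdjoinRoot.mk h))) :
    (∀ i < e, ∃ s t, G.coeff i = p * s + h * t) ∧
      ∃ D t, G.coeff 0 = p * D + h * t ∧ ¬ ∃ s t, D = p * s + h * t := by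
  obtain ⟨-, -, h1, h2⟩ := (isPEisenstein_iff hE.not_isUnit).1 hE
  have key (i) (hi : i < e) : ∃ s t, G.coeff i = p * s + h * t := by
    obtain ⟨z, hz⟩ := h1 i hi
    obtain ⟨s, rfl⟩ := AdjoinRoot.mk_surjective z
    rw [coeff_map, ← map_natCast (AdjoinRoot.mk h), ← map_mul, AdjoinRoot.mk_eq_mk] at hz
    obtain ⟨t, ht⟩ := hz
    exact ⟨s, t, by linear_combination ht⟩
  refine ⟨key, ?_⟩
  obtain ⟨D, t, hD⟩ := key 0 he
  refine ⟨D, t, hD, ?_⟩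
  rintro ⟨s, t', rfl⟩
  refine h2 ⟨AdjoinRoot.mk h s, ?_⟩
  rw [coeff_map, hD]
  simp only [map_add, map_mul, map_natCast, AdjoinRoot.mk_self]
  ring

theorem forall_isUnit_or_dvd_of_presentation (hp : p.Prime) (hh : IsInertPolynomial f p h)
    (he : 0 < e) (hG : G.Monic) (hGe : G.natDegree = e)
    (hE : IsPEisenstein p e (G.map (AdjoinRoot.mk h))) {A : Type*} [CommRing A]
    (q : ℤ[X][X] →+* A) (hq : Function.Surjective q) (hqp : IsNilpotent (p : A))
    (hqh : q (C h) = 0) (hqG : q G = 0) (x : A) : IsUnit x ∨ q X ∣ x := by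
  obtain ⟨hcoeff, D, t, h0, hD⟩ := exists_coeff_eq_of_isPEisenstein_map he hE
  have hdu : IsUnit (q (C D)) := by
    rcases hh.mem_or_exists_inverse hp D with h1 | ⟨P', s, t, h1⟩
    · exact absurd h1 hD
    · refine isUnit_of_mul_isUnit_left (y := q (C P')) ?_
      rw [← map_mul, ← map_mul, h1]
      simp only [map_add, map_one, map_mul, hqh, zero_mul, add_zero, map_natCast]
      exact ((Commute.all _ _).isNilpotent_mul_right hqp).isUnit_one_add
  exact (forall_isUnit_or_dvd_of_eisenstein q hq hqp
    (hh.isUnit_or_dvd hp hqp (q.comp C) hqh) hG hGe he hqG (fun i hi => by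
      obtain ⟨s, t, hst⟩ := hcoeff i hi
      rw [hst]
      simp [hqh]) hdu (by rw [h0]; simp [hqh])).2.2 x

/-- The target `B` is left general because it will be both `R` and a quotient of the localization
`D`. -/
theorem exists_presentation_equiv (hp : p.Prime) (hh : IsInertPolynomial f p h) (he : 0 < e)
    (hG : G.Monic) (hGe : G.natDegree = e) (hE : IsPEisenstein p e (G.map (AdjoinRoot.mk h)))
    {B : Type*} [CommRing B] {N : ℕ} {β y : B} (hpN : (p : B) ^ N = 0) (hβ : aeval β h = 0)
    (hGy : G.eval₂ (aeval β : ℤ[X] →ₐ[ℤ] B).toRingHom y = 0) (hya : y ^ a = 0)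
    (hmin : ∀ j, y ^ j = 0 → a ≤ j) (hres : ∀ x, ∃ P : ℤ[X], y ∣ x - aeval β P) :
    ∃ φ : (ℤ[X][X] ⧸ presentationIdeal (p ^ N) a h G) ≃+* B,
      φ (Ideal.Quotient.mk _ (C X)) = β ∧ φ (Ideal.Quotient.mk _ X) = y := by
  set J := presentationIdeal (p ^ N) a h G with hJdef
  let φ₀ : ℤ[X][X] →+* B := eval₂RingHom (aeval β : ℤ[X] →ₐ[ℤ] B).toRingHom y
  have hφ₀C (P : ℤ[X]) : φ₀ (C P) = aeval β P := eval₂_C _ _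
  have hφ₀X : φ₀ X = y := eval₂_X _ _
  have hJ : ∀ x ∈ J, φ₀ x = 0 := by
    change J ≤ RingHom.ker φ₀
    rw [hJdef, presentationIdeal, Ideal.span_le]
    rintro x (rfl | rfl | rfl | rfl)
    · rw [SetLike.mem_coe, RingHom.mem_ker, map_natCast, Nat.cast_pow, hpN]
    · rw [SetLike.mem_coe, RingHom.mem_ker, map_pow, hφ₀X, hya]
    · exact hGy
    · rw [SetLike.mem_coe, RingHom.mem_ker, hφ₀C, hβ]
  let q := Ideal.Quotient.mk J
  have hφ (x : ℤ[X][X]) : Ideal.Quotient.lift J φ₀ hJ (q x) = φ₀ x := Ideal.Quotient.lift_mk _ _ _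
  have hq {x : ℤ[X][X]} (hx : x ∈ ({((p ^ N : ℕ) : ℤ[X][X]), X ^ a, G, C h} : Set ℤ[X][X])) :
      q x = 0 := Ideal.Quotient.eq_zero_iff_mem.2 (Ideal.subset_span hx)
  have hqp : IsNilpotent (p : ℤ[X][X] ⧸ J) :=
    ⟨N, by rw [← Nat.cast_pow, ← map_natCast q]; exact hq (by simp)⟩
  have hqh : q (C h) = 0 := hq (by simp)
  have hqX : q X ^ a = 0 := by rw [← map_pow]; exact hq (by simp)
  have hA := forall_isUnit_or_dvd_of_presentation (A := ℤ[X][X] ⧸ J) hp hh he hG hGe hE q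
    Ideal.Quotient.mk_surjective hqp hqh (hq (by simp))
  have hb : Function.Bijective (Ideal.Quotient.lift J φ₀ hJ) := by
    refine bijective_of_forall_exists_dvd_sub _ hqX hA (fun x => ?_)
      fun j hj => hmin j (by rwa [hφ, hφ₀X] at hj)
    obtain ⟨P, hP⟩ := hres x
    exact ⟨q (C P), by rwa [hφ, hφ, hφ₀X, hφ₀C]⟩
  exact ⟨RingEquiv.ofBijective _ hb, (hφ _).trans ((hφ₀C X).trans (aeval_X _)), (hφ _).trans hφ₀X⟩

variable {R : Type*} [CommRing R] [IsLocalRing R] {π b : R}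

theorem IsCoefficientRing.exists_integer_lift (hR : HasParameters R a e f p) {S : Subring R}
    (hS : IsCoefficientRing R p S) {g : S[X]} (hg : IsPEisenstein p e g)
    (hh : IsInertPolynomial f p h) (hb : aeval b h = 0) :
    ∃ G : ℤ[X][X], G.Monic ∧ G.natDegree = e ∧ IsPEisenstein p e (G.map (AdjoinRoot.mk h)) ∧
      G.map (aeval b : ℤ[X] →ₐ[ℤ] R).toRingHom = g.map S.subtype := by
  obtain rfl := hS.eq_intAdjoin hR hh hb
  obtain ⟨h1, h2, h3, h4⟩ := (isPEisenstein_iff hg.not_isUnit).1 hg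
  have hP : ∀ i < e, ∃ P : ℤ[X], (g.coeff i : R) = p * aeval b P := by
    intro i hi
    obtain ⟨⟨_, P, rfl⟩, hz⟩ := h3 i hi
    exact ⟨P, by rw [hz]; simp⟩
  choose! P hP using hP
  have hnu : ¬ IsUnit (p : AdjoinRoot h) := fun hu => by
    have := hu.map (AdjoinRoot.lift (algebraMap ℤ R) b hb)
    rw [map_natCast] at this
    exact hR.isNilpotent_cast.not_isUnit this
  have : Nontrivial (AdjoinRoot h) := (AdjoinRoot.lift (algebraMap ℤ R) b hb).domain_nontrivial
  -- Lifting the quotients by `p` instead of the coefficients themselves makes divisibility by `p`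
  -- hold already in `ℤ[X]`.
  refine ⟨monicOfCoeff e fun i => p * P i, monic_monicOfCoeff _ _, natDegree_monicOfCoeff _ _, ?_,
    ?_⟩
  · rw [map_monicOfCoeff]
    refine (isPEisenstein_iff hnu).2 ⟨monic_monicOfCoeff _ _, natDegree_monicOfCoeff _ _,
      fun i hi => ?_, ?_⟩
    · rw [coeff_monicOfCoeff _ hi]
      simp
    · rw [coeff_monicOfCoeff _ hR.e_pos]
      rintro ⟨z, hz⟩
      obtain ⟨s, rfl⟩ := AdjoinRoot.mk_surjective z
      rw [← map_natCast (AdjoinRoot.mk h), ← map_pow, ← map_mul, AdjoinRoot.mk_eq_mk] at hz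
      obtain ⟨t, ht⟩ := hz
      -- From `p * P 0 ≡ p ^ 2 * s` modulo `h` one may cancel `p`; evaluating at `b` then puts
      -- `g.coeff 0` in `p ^ 2 S`.
      obtain ⟨r, hr⟩ := hh.exists_eq_of_cast_mul hR.prime (P := P 0 - p * s) (r := t)
        (by linear_combination ht)
      refine h4 ⟨⟨aeval b s, s, rfl⟩, Subtype.ext ?_⟩
      have h5 := congrArg (aeval b) hr
      rw [map_mul, hb, zero_mul, map_sub, map_mul, map_natCast, sub_eq_zero] at h5
      rw [hP 0 hR.e_pos, h5]
      push_cast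
      ring
  · rw [map_monicOfCoeff, ← monicOfCoeff_coeff (h1.map (intAdjoin b).subtype)
      ((natDegree_map_eq_of_injective (intAdjoin b).subtype_injective g).trans h2)]
    refine monicOfCoeff_congr fun i hi => ?_
    rw [coeff_map, Subring.subtype_apply, hP i hi, map_mul, map_natCast]
    rfl

theorem HasParameters.exists_presentation_equiv (hR : HasParameters R a e f p)
    (hπ : IsUniformizer R π) (hea : e < a) (hh : IsInertPolynomial f p h) (hb : aeval b h = 0)
    (hG : G.Monic) (hGe : G.natDegree = e) (hE : IsPEisenstein p e (G.map (AdjoinRoot.mk h)))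
    (hGπ : (G.map (aeval b : ℤ[X] →ₐ[ℤ] R).toRingHom).eval π = 0) :
    ∃ φ : (ℤ[X][X] ⧸ presentationIdeal (p ^ (a ⌈/⌉ e)) a h G) ≃+* R,
      φ (Ideal.Quotient.mk _ (C X)) = b ∧ φ (Ideal.Quotient.mk _ X) = π := by
  refine _root_.exists_presentation_equiv hR.prime hh hR.e_pos hG hGe hE ?_ hb
    (by rwa [eval_map] at hGπ) (hR.pow_eq_zero hπ) (fun j => hR.le_of_pow_eq_zero hπ) fun x => ?_
  · rw [hR.cast_pow_eq_zero_iff hπ hea, ← ceilDiv_le_iff_le_mul hR.e_pos]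
  · obtain ⟨P, hP⟩ := hR.residue_comp_aeval_surjective hh hb (residue R x)
    refine ⟨P, ?_⟩
    rw [← Ideal.mem_span_singleton, ← hπ, ← residue_eq_zero_iff, map_sub, hP, sub_self]

end Presentation

/-! ### The number field model -/

section NumberFieldModel

variable {a e f p : ℕ} {h : ℤ[X]} {G : ℤ[X][X]}

theorem card_ringOfIntegers_quotient_span (K : Type*) [Field K] [NumberField K] (p : ℕ) :
    Nat.card (𝓞 K ⧸ Ideal.span {(p : 𝓞 K)}) = p ^ Module.finrank ℚ K := by
  have h1 := Ideal.absNorm_apply (Ideal.span {(p : 𝓞 K)})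
  rw [Submodule.cardQuot_apply] at h1
  have h2 : (p : 𝓞 K) = algebraMap ℤ (𝓞 K) (p : ℤ) := by simp
  rw [← h1, Ideal.absNorm_span_singleton, h2, Algebra.norm_algebraMap, RingOfIntegers.rank]
  simp [Int.natAbs_pow]

/-- The quotient by `p` has `p ^ f` elements and contains a root of `h`, so it is `𝔽_p[X] / (h)`. No
comparison of `ℤ[β]` with `𝓞 K` is needed. -/
theorem IsInertPolynomial.isPrime_span (hp : p.Prime) (hh : IsInertPolynomial f p h)
    {K : Type*} [Field K] [NumberField K] (hK : Module.finrank ℚ K = f) {β : 𝓞 K}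
    (hβ : aeval β h = 0) :
    (Ideal.span {(p : 𝓞 K)}).IsPrime ∧
      ∀ P : ℤ[X], aeval β P ∈ Ideal.span {(p : 𝓞 K)} → ∃ s t, P = p * s + h * t := by
  set J := Ideal.span {(p : 𝓞 K)} with hJ
  have hf : f ≠ 0 := hK ▸ Module.finrank_pos.ne'
  have hcard : Nat.card (𝓞 K ⧸ J) = p ^ f := by rw [card_ringOfIntegers_quotient_span, hK]
  have hfin : Finite (𝓞 K ⧸ J) :=
    Nat.finite_of_card_ne_zero (by rw [hcard]; exact pow_ne_zero _ hp.ne_zero)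
  have hnt : Nontrivial (𝓞 K ⧸ J) := by
    rw [← Finite.one_lt_card_iff_nontrivial, hcard]
    exact Nat.one_lt_pow hf hp.one_lt
  have hp0 : (p : 𝓞 K ⧸ J) = 0 := by
    rw [← map_natCast (Ideal.Quotient.mk J)]
    exact Ideal.Quotient.eq_zero_iff_mem.2 (Ideal.mem_span_singleton_self _)
  have hmap := ringHom_aeval_int (B := 𝓞 K ⧸ J) (Ideal.Quotient.mk J) β
  have hβ' := hmap h
  rw [hβ, map_zero] at hβ'
  refine ⟨?_, fun P hP => ?_⟩
  · have := hh.isField_of_card (Q := 𝓞 K ⧸ J) hp hp0 hβ'.symm hcard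
    exact (Ideal.Quotient.maximal_of_isField J this).isPrime
  · exact hh.exists_eq_of_map_eq_zero hp (A := 𝓞 K ⧸ J)
      ((Ideal.Quotient.mk J).comp (aeval β : ℤ[X] →ₐ[ℤ] 𝓞 K).toRingHom) hp0
      (hmap h |>.trans hβ'.symm) (Ideal.Quotient.eq_zero_iff_mem.2 hP)

/-- Eisenstein's criterion over `𝓞 K` at the prime `p`, followed by descent of factorizations from
`K` to the integrally closed `𝓞 K`. -/
theorem irreducible_map_of_isPEisenstein (hp : p.Prime) (hh : IsInertPolynomial f p h)
    (he : 0 < e) (hG : G.Monic) (hGe : G.natDegree = e)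
    (hE : IsPEisenstein p e (G.map (AdjoinRoot.mk h))) {K : Type*} [Field K] [NumberField K]
    (hK : Module.finrank ℚ K = f) {β : 𝓞 K} (hβ : aeval β h = 0) :
    Irreducible (G.map (aeval (β : K) : ℤ[X] →ₐ[ℤ] K).toRingHom) := by
  obtain ⟨hprime, hmem⟩ := hh.isPrime_span hp hK hβ
  obtain ⟨hcoeff, D, t, h0, hD⟩ := exists_coeff_eq_of_isPEisenstein_map he hE
  let θ : ℤ[X] →+* 𝓞 K := (aeval β : ℤ[X] →ₐ[ℤ] 𝓞 K).toRingHom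
  have hθ : θ h = 0 := hβ
  have hcomp : (algebraMap (𝓞 K) K).comp θ = (aeval (β : K) : ℤ[X] →ₐ[ℤ] K).toRingHom :=
    RingHom.ext fun P => (aeval_algebraMap_apply K β P).symm
  have hm : (G.map θ).Monic := hG.map θ
  have hp0 : (p : 𝓞 K) ≠ 0 := Nat.cast_ne_zero.2 hp.ne_zero
  have hE' : IsPEisenstein p e (G.map θ) := by
    refine (isPEisenstein_iff ?_).2 ⟨hm, hG.natDegree_map θ |>.trans hGe, fun i hi => ?_, ?_⟩
    · rw [← Ideal.span_singleton_eq_top]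
      exact hprime.ne_top
    · obtain ⟨s, t, hst⟩ := hcoeff i hi
      rw [coeff_map, hst]
      simp [hθ]
    · rintro ⟨z, hz⟩
      refine hD (hmem D (Ideal.mem_span_singleton.2 ⟨z, mul_left_cancel₀ hp0 ?_⟩))
      rw [coeff_map, h0, map_add, map_mul, map_mul, hθ, map_natCast] at hz
      change (p : 𝓞 K) * θ D = _
      linear_combination hz
  have hirr := hE'.2.2.irreducible hprime hm.isPrimitive (by rw [hE'.2.1]; exact he)
  rw [hm.irreducible_iff_irreducible_map_fraction_map (K := K), Polynomial.map_map, hcomp] at hirr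
  exact hirr

theorem IsInertPolynomial.irreducible_map_rat (hp : p.Prime) (hh : IsInertPolynomial f p h) :
    Irreducible (h.map (Int.castRingHom ℚ)) := by
  have : Fact p.Prime := ⟨hp⟩
  exact (hh.monic.irreducible_iff_irreducible_map_fraction_map (K := ℚ)).1
    (hh.monic.irreducible_of_irreducible_map (Int.castRingHom (ZMod p)) h hh.2.2)

theorem exists_numberField_isAdjoinRoot_rat {q : ℚ[X]} (hq : Irreducible q) (hm : q.Monic) :
    ∃ (K : Type) (_ : Field K) (_ : NumberField K), Nonempty (IsAdjoinRoot K q) ∧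
      Module.finrank ℚ K = q.natDegree := by
  have := Fact.mk hq
  let K := AdjoinRoot q
  have hchar : CharZero K := charZero_of_injective_algebraMap (algebraMap ℚ K).injective
  -- `NumberField` refers to the `ℚ`-algebra structure of a division ring of characteristic zero,
  -- not to the one `AdjoinRoot` inherits as a quotient, so the former is named throughout.
  let i : @IsAdjoinRoot ℚ K _ _ DivisionRing.toRatAlgebra q :=
    @IsAdjoinRoot.mk ℚ K _ _ DivisionRing.toRatAlgebra q
      (@RingHom.toRatAlgHom ℚ[X] K _ _ _ DivisionRing.toRatAlgebra (AdjoinRoot.mk q))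
      AdjoinRoot.mk_surjective Ideal.mk_ker
  let j : @IsAdjoinRootMonic ℚ K _ _ DivisionRing.toRatAlgebra q :=
    @IsAdjoinRootMonic.mk ℚ K _ _ DivisionRing.toRatAlgebra q i hm
  have hfin := (@IsAdjoinRootMonic.powerBasis ℚ K _ _ q DivisionRing.toRatAlgebra j).finite
  exact ⟨K, inferInstance, @NumberField.mk K _ hchar hfin, ⟨i⟩,
    @IsAdjoinRootMonic.finrank ℚ K _ _ q DivisionRing.toRatAlgebra j _⟩

theorem exists_numberField_isAdjoinRoot {K : Type} [Field K] [NumberField K] {q : K[X]}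
    (hq : Irreducible q) (hm : q.Monic) :
    ∃ (L : Type) (_ : Field L) (_ : NumberField L) (_ : Algebra K L),
      Nonempty (IsAdjoinRoot L q) ∧ Module.finrank K L = q.natDegree := by
  have := Fact.mk hq
  let L := AdjoinRoot q
  have hchar : CharZero L := charZero_of_injective_algebraMap (algebraMap K L).injective
  let j : IsAdjoinRootMonic L q := AdjoinRoot.isAdjoinRootMonic q hm
  have hfin : FiniteDimensional K L := j.powerBasis.finite
  have htower : IsScalarTower ℚ K L := IsScalarTower.of_algebraMap_eq' (Subsingleton.elim _ _)
  exact ⟨L, inferInstance, @NumberField.mk L _ hchar (FiniteDimensional.trans ℚ K L), inferInstance,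
    ⟨j.toIsAdjoinRoot⟩, j.finrank⟩

theorem exists_prime_pow_eq_span (hp : p.Prime) (hh : IsInertPolynomial f p h) (he : 0 < e)
    (hG : G.Monic) (hGe : G.natDegree = e) (hE : IsPEisenstein p e (G.map (AdjoinRoot.mk h)))
    {L : Type*} [Field L] [NumberField L] (hL : Module.finrank ℚ L = f * e) {β γ : 𝓞 L}
    (hβ : aeval β h = 0) (hγ : G.eval₂ (aeval β : ℤ[X] →ₐ[ℤ] 𝓞 L).toRingHom γ = 0) :
    ∃ P : Ideal (𝓞 L), P.IsMaximal ∧ P ≠ ⊥ ∧ Ideal.span {(p : 𝓞 L)} = P ^ e ∧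
      Nat.card (𝓞 L ⧸ P) = p ^ f ∧ γ ∈ P ∧ ∃ w ∉ P, γ ^ e = p * w := by
  obtain ⟨hcoeff, D, t, h0, hD⟩ := exists_coeff_eq_of_isPEisenstein_map he hE
  set θ : ℤ[X] →+* 𝓞 L := (aeval β : ℤ[X] →ₐ[ℤ] 𝓞 L).toRingHom with hθdef
  have hθ : θ h = 0 := hβ
  obtain ⟨t', ht'⟩ := exists_pow_eq_of_eval₂_eq_zero (ϖ := (p : 𝓞 L)) (d := θ D) θ hG hGe he hγ
    (fun i hi => by
      obtain ⟨s, t, hst⟩ := hcoeff i hi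
      rw [hst]
      simp [hθ]) (by rw [h0]; simp [hθ])
  have hp0 : (p : 𝓞 L) ≠ 0 := Nat.cast_ne_zero.2 hp.ne_zero
  have hnorm : Ideal.absNorm (Ideal.span {(p : 𝓞 L)}) = (p ^ f) ^ e := by
    rw [Ideal.absNorm_apply, Submodule.cardQuot_apply, card_ringOfIntegers_quotient_span, hL,
      pow_mul]
  have hfe : f * e ≠ 0 := hL ▸ Module.finrank_pos.ne'
  have htop : Ideal.span {(p : 𝓞 L)} ≠ ⊤ := by
    rw [Ne, ← Ideal.absNorm_eq_one_iff, hnorm, ← pow_mul]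
    exact (Nat.one_lt_pow hfe hp.one_lt).ne'
  obtain ⟨P, hPmax, hPp⟩ := Ideal.exists_le_maximal _ htop
  rw [Ideal.span_singleton_le_iff_mem] at hPp
  have hP0 : P ≠ ⊥ := fun h => hp0 (by rwa [h, Ideal.mem_bot] at hPp)
  have hγP : γ ∈ P := hPmax.isPrime.mem_of_pow_mem e (ht' ▸ Ideal.mul_mem_right _ _ hPp)
  have hpQ : (p : 𝓞 L ⧸ P) = 0 := by
    rw [← map_natCast (Ideal.Quotient.mk P)]
    exact Ideal.Quotient.eq_zero_iff_mem.2 hPp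
  have hnt : Nontrivial (𝓞 L ⧸ P) := Ideal.Quotient.nontrivial_iff.2 hPmax.ne_top
  have hfin : Finite (𝓞 L ⧸ P) := Ideal.finiteQuotientOfFreeOfNeBot P hP0
  have hmap := ringHom_aeval_int (B := 𝓞 L ⧸ P) (Ideal.Quotient.mk P) β
  have hβ' := hmap h
  rw [hβ, map_zero] at hβ'
  have hDP : θ D ∉ P := fun hmem => hD (hh.exists_eq_of_map_eq_zero hp (A := 𝓞 L ⧸ P)
    ((Ideal.Quotient.mk P).comp θ) hpQ (hmap h |>.trans hβ'.symm)
    (Ideal.Quotient.eq_zero_iff_mem.2 hmem))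
  have hwP : -(θ D + γ * t') ∉ P := by
    rw [neg_mem_iff]
    exact fun hmem => hDP ((Ideal.add_mem_iff_left P (Ideal.mul_mem_right _ _ hγP)).1 hmem)
  have hle : p ^ f ≤ Ideal.absNorm P := by
    rw [Ideal.absNorm_apply, Submodule.cardQuot_apply]
    exact (hh.pow_le_card_and_surjective (Q := 𝓞 L ⧸ P) hp hpQ hβ'.symm).1
  have hPprime : Prime P := Ideal.prime_of_isPrime hP0 hPmax.isPrime
  -- `P ^ e` divides `(γ) ^ e = (p)(w)` and `P` does not divide `(w)`.
  obtain ⟨J, hJ⟩ : P ^ e ∣ Ideal.span {(p : 𝓞 L)} := by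
    refine hPprime.pow_dvd_of_dvd_mul_right (b := Ideal.span {-(θ D + γ * t')}) e ?_ ?_
    · rwa [Ideal.dvd_span_singleton]
    · rw [Ideal.span_singleton_mul_span_singleton, ← ht', ← Ideal.span_singleton_pow]
      exact pow_dvd_pow_of_dvd (Ideal.dvd_span_singleton.2 hγP) e
  have hnorm' := hnorm
  rw [hJ, map_mul, map_pow] at hnorm'
  have hpos : 0 < (p ^ f) ^ e := pow_pos (pow_pos hp.pos f) e
  have hle' : (p ^ f) ^ e ≤ Ideal.absNorm P ^ e := Nat.pow_le_pow_left hle e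
  -- The norm of `(p)` is `p ^ (f * e)`, and `P ^ e` alone accounts for at least that much, so no
  -- room is left for `J`.
  have hJ1 : Ideal.absNorm J = 1 := by
    have h1 : Ideal.absNorm J ≠ 0 := fun h => by rw [h, mul_zero] at hnorm'; omega
    have h2 : Ideal.absNorm J ≤ 1 := by
      by_contra! h
      nlinarith
    omega
  rw [hJ1, mul_one] at hnorm'
  rw [Ideal.absNorm_eq_one_iff.1 hJ1, Ideal.mul_top] at hJ
  refine ⟨P, hPmax, hP0, hJ, ?_, hγP, _, hwP, ht'⟩
  have := Nat.pow_left_injective he.ne' hnorm'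
  rwa [Ideal.absNorm_apply, Submodule.cardQuot_apply] at this

theorem exists_presentation_equiv_of_isLocalRing (hp : p.Prime) (hh : IsInertPolynomial f p h)
    (he : 0 < e) (hG : G.Monic) (hGe : G.natDegree = e)
    (hE : IsPEisenstein p e (G.map (AdjoinRoot.mk h))) {N : ℕ} (hN : a ≤ e * N) {D B : Type*}
    [CommRing D] [IsDomain D] [IsLocalRing D] [CommRing B] (q : D →+* B)
    (hqs : Function.Surjective q) {β y w : D} (hq : ∀ x, q x = 0 ↔ y ^ a ∣ x)
    (hy : maximalIdeal D = Ideal.span {y}) (hy0 : y ≠ 0) (hw : IsUnit w) (hyw : y ^ e = p * w)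
    (hcard : Nat.card (ResidueField D) = p ^ f) (hβ : aeval β h = 0)
    (hGy : G.eval₂ (aeval β : ℤ[X] →ₐ[ℤ] D).toRingHom y = 0) :
    Nonempty ((ℤ[X][X] ⧸ presentationIdeal (p ^ N) a h G) ≃+* B) := by
  have hymem : y ∈ maximalIdeal D := hy ▸ Ideal.mem_span_singleton_self y
  have hyu : ¬ IsUnit y := (mem_maximalIdeal y).1 hymem
  have hβq := ringHom_aeval_int q β
  have hcomp : q.comp (aeval β : ℤ[X] →ₐ[ℤ] D).toRingHom =
      (aeval (q β) : ℤ[X] →ₐ[ℤ] B).toRingHom := RingHom.ext hβq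
  have hfin : Finite (ResidueField D) :=
    Nat.finite_of_card_ne_zero (by rw [hcard]; exact pow_ne_zero _ hp.ne_zero)
  have hpres : (p : ResidueField D) = 0 := by
    rw [← map_natCast (residue D), residue_eq_zero_iff, ← Ideal.mul_unit_mem_iff_mem _ hw, ← hyw]
    exact Ideal.pow_mem_of_mem _ hymem e he
  refine (exists_presentation_equiv (N := N) (a := a) (β := q β) (y := q y) hp hh he hG
    hGe hE ?_ ?_ ?_ ?_ (fun j hj => ?_) (fun x => ?_)).elim fun φ _ => ⟨φ⟩
  · rw [← map_natCast q, ← map_pow, hq]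
    refine (pow_dvd_pow y hN).trans ?_
    rw [pow_mul, hyw, mul_pow, (hw.pow N).mul_right_dvd]
  · rw [← hβq, hβ, map_zero]
  · have := congrArg q hGy
    rwa [hom_eval₂, map_zero, hcomp] at this
  · rw [← map_pow, hq]
  · rw [← map_pow, hq] at hj
    exact (pow_dvd_pow_iff hy0 hyu).1 hj
  · obtain ⟨x, rfl⟩ := hqs x
    have hres := ringHom_aeval_int (residue D) β
    have hresh := hres h
    rw [hβ, map_zero] at hresh
    obtain ⟨Q, hQ⟩ := (hh.pow_le_card_and_surjective hp hpres hresh.symm).2 hcard (residue D x)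
    refine ⟨Q, ?_⟩
    rw [← hβq, ← map_sub]
    refine map_dvd q ?_
    rw [← Ideal.mem_span_singleton, ← hy, ← residue_eq_zero_iff, map_sub, hres, hQ, sub_self]

theorem exists_localization_equiv (hp : p.Prime) (hh : IsInertPolynomial f p h) (he : 0 < e)
    (hG : G.Monic) (hGe : G.natDegree = e) (hE : IsPEisenstein p e (G.map (AdjoinRoot.mk h)))
    {N : ℕ} (hN : a ≤ e * N) {O : Type*} [CommRing O] [IsDedekindDomain O] {P : Ideal O}
    [hPmax : P.IsMaximal] (hP0 : P ≠ ⊥) (hpP : Ideal.span {(p : O)} = P ^ e)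
    (hcard : Nat.card (O ⧸ P) = p ^ f) {β γ w : O} (hγP : γ ∈ P) (hw : w ∉ P)
    (hγw : γ ^ e = p * w) (hβ : aeval β h = 0)
    (hγ : G.eval₂ (aeval β : ℤ[X] →ₐ[ℤ] O).toRingHom γ = 0) (D : Type*) [CommRing D]
    [IsDomain D] [IsLocalRing D] [Algebra O D] [IsLocalization.AtPrime D P] :
    IsDiscreteValuationRing D ∧ Ideal.span {(p : D)} = maximalIdeal D ^ e ∧
      Nat.card (ResidueField D) = p ^ f ∧
      (P ^ a).map (algebraMap O D) = Ideal.span {algebraMap O D γ ^ a} ∧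
      Nonempty ((ℤ[X][X] ⧸ presentationIdeal (p ^ N) a h G) ≃+*
        D ⧸ (P ^ a).map (algebraMap O D)) := by
  have hDVR : IsDiscreteValuationRing D :=
    IsLocalization.AtPrime.isDiscreteValuationRing_of_dedekind_domain O hP0 D
  have hmap : P.map (algebraMap O D) = maximalIdeal D :=
    IsLocalization.AtPrime.map_eq_maximalIdeal P D
  have hpD : Ideal.span {(p : D)} = maximalIdeal D ^ e := by
    rw [← hmap, ← Ideal.map_pow, ← hpP, Ideal.map_span, Set.image_singleton, map_natCast]
  have hcardD : Nat.card (ResidueField D) = p ^ f := by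
    rw [← hcard]
    exact (Nat.card_congr (IsLocalization.AtPrime.equivQuotMaximalIdeal P D).toEquiv).symm
  set y := algebraMap O D γ with hy
  have hwD : IsUnit (algebraMap O D w) := (IsLocalization.AtPrime.isUnit_to_map_iff D P w).2 hw
  have hyw : y ^ e = p * algebraMap O D w := by
    rw [hy, ← map_pow, hγw, map_mul, map_natCast]
  have hymem : y ∈ maximalIdeal D := hmap ▸ Ideal.mem_map_of_mem _ hγP
  have hymax : maximalIdeal D = Ideal.span {y} := by
    obtain ⟨ϖ, hϖ⟩ := IsDiscreteValuationRing.exists_irreducible D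
    have hmaxϖ := hϖ.maximalIdeal_eq
    obtain ⟨z, hz⟩ := Ideal.mem_span_singleton.1 (hmaxϖ ▸ hymem)
    -- Both ideals are `(p)`. Cancelling `ϖ ^ e` in the domain `D` shows that `y / ϖ` is a unit.
    have h1 : Ideal.span {ϖ ^ e} = Ideal.span {y ^ e} := by
      rw [hyw, Ideal.span_singleton_mul_right_unit hwD, hpD, hmaxϖ, Ideal.span_singleton_pow]
    have h2 : ϖ ^ e * z ^ e ∣ ϖ ^ e * 1 := by
      rw [← mul_pow, ← hz, mul_one]
      exact Ideal.span_singleton_le_span_singleton.1 h1.le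
    have h3 := (mul_dvd_mul_iff_left (pow_ne_zero e hϖ.ne_zero)).1 h2
    have hzu : IsUnit z := (isUnit_pow_iff he.ne').1 (isUnit_of_dvd_one h3)
    rw [hmaxϖ, hz, Ideal.span_singleton_mul_right_unit hzu]
  have hPa : (P ^ a).map (algebraMap O D) = Ideal.span {y ^ a} := by
    rw [Ideal.map_pow, hmap, hymax, Ideal.span_singleton_pow]
  have hy0 : y ≠ 0 := fun h0 => IsDiscreteValuationRing.not_a_field D (by
    rw [hymax, h0, Ideal.span_singleton_eq_bot])
  have hβD := ringHom_aeval_int (algebraMap O D) β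
  have hcomp : (algebraMap O D).comp (aeval β : ℤ[X] →ₐ[ℤ] O).toRingHom =
      (aeval (algebraMap O D β) : ℤ[X] →ₐ[ℤ] D).toRingHom := RingHom.ext hβD
  refine ⟨hDVR, hpD, hcardD, hPa, exists_presentation_equiv_of_isLocalRing
    (β := algebraMap O D β) (B := D ⧸ (P ^ a).map (algebraMap O D)) hp hh he hG hGe hE hN
    (Ideal.Quotient.mk _) Ideal.Quotient.mk_surjective (fun x => ?_) hymax hy0 hwD hyw hcardD
    (by rw [← hβD, hβ, map_zero]) ?_⟩
  · rw [Ideal.Quotient.eq_zero_iff_mem, hPa, Ideal.mem_span_singleton]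
  · have := congrArg (algebraMap O D) hγ
    rwa [hom_eval₂, map_zero, hcomp] at this

/-- `R` enters only through its presentation: the fields are built from `h` and `G` alone, and the
localization's quotient has the same presentation. -/
theorem hasNumberFieldModel_of_presentation_equiv {R : Type*} [CommRing R] (hp : p.Prime)
    (hh : IsInertPolynomial f p h) (he : 0 < e) (hG : G.Monic) (hGe : G.natDegree = e)
    (hE : IsPEisenstein p e (G.map (AdjoinRoot.mk h))) {N : ℕ} (hN : a ≤ e * N)
    (φ : (ℤ[X][X] ⧸ presentationIdeal (p ^ N) a h G) ≃+* R) :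
    HasNumberFieldModel R a e f p h G := by
  obtain ⟨K, _, _, ⟨hK⟩, hKf⟩ := exists_numberField_isAdjoinRoot_rat (hh.irreducible_map_rat hp)
    (hh.monic.map _)
  rw [hh.monic.natDegree_map, hh.2.1] at hKf
  have hroot : aeval hK.root h = 0 := by
    have := hK.aeval_root_self
    rwa [aeval_def, eval₂_map, RingHom.ext_int ((algebraMap ℚ K).comp _) (algebraMap ℤ K)] at this
  let β : 𝓞 K := ⟨hK.root, h, hh.monic, hroot⟩
  have hβ : aeval β h = 0 := RingOfIntegers.coe_injective (by
    rw [← aeval_algebraMap_apply, map_zero]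
    exact hroot)
  obtain ⟨L, _, _, _, ⟨hL⟩, hLe⟩ := exists_numberField_isAdjoinRoot
    (irreducible_map_of_isPEisenstein hp hh he hG hGe hE hKf hβ) (hG.map _)
  rw [hG.natDegree_map, hGe] at hLe
  have hLfe : Module.finrank ℚ L = f * e := by
    rw [← Module.finrank_mul_finrank ℚ K L, hKf, hLe]
  let β' : 𝓞 L := algebraMap (𝓞 K) (𝓞 L) β
  have hβ' : aeval β' h = 0 := by
    have := ringHom_aeval_int (algebraMap (𝓞 K) (𝓞 L)) β h
    rw [hβ, map_zero] at this
    exact this.symm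
  let θ : ℤ[X] →+* 𝓞 K := (aeval β : ℤ[X] →ₐ[ℤ] 𝓞 K).toRingHom
  have hcompK : (algebraMap (𝓞 K) L).comp θ =
      (algebraMap K L).comp (aeval hK.root : ℤ[X] →ₐ[ℤ] K).toRingHom := by
    refine Polynomial.ringHom_ext' (RingHom.ext_int _ _) ?_
    simp only [θ, RingHom.comp_apply, AlgHom.toRingHom_eq_coe, RingHom.coe_coe, aeval_X]
    rfl
  have hcompL : (algebraMap (𝓞 L) L).comp (aeval β' : ℤ[X] →ₐ[ℤ] 𝓞 L).toRingHom =
      (algebraMap K L).comp (aeval hK.root : ℤ[X] →ₐ[ℤ] K).toRingHom := by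
    refine Polynomial.ringHom_ext' (RingHom.ext_int _ _) ?_
    simp only [RingHom.comp_apply, AlgHom.toRingHom_eq_coe, RingHom.coe_coe, aeval_X]
    rfl
  have hLroot := hL.aeval_root_self
  rw [aeval_def, eval₂_map] at hLroot
  have hint : IsIntegral ℤ hL.root := by
    refine isIntegral_trans (A := 𝓞 K) _ ⟨G.map θ, hG.map θ, ?_⟩
    rw [eval₂_map, hcompK]
    exact hLroot
  let γ : 𝓞 L := ⟨hL.root, hint⟩
  have hγ : G.eval₂ (aeval β' : ℤ[X] →ₐ[ℤ] 𝓞 L).toRingHom γ = 0 := by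
    refine RingOfIntegers.coe_injective ?_
    rw [hom_eval₂, hcompL, map_zero]
    exact hLroot
  obtain ⟨P, hPmax, hP0, hpP, hcard, hγP, w, hw, hγw⟩ :=
    exists_prime_pow_eq_span hp hh he hG hGe hE hLfe hβ' hγ
  have hPprime := hPmax.isPrime
  have hpmem : (p : 𝓞 L) ∈ P :=
    Ideal.pow_le_self he.ne' (hpP ▸ Ideal.mem_span_singleton_self _)
  have hmaxZ : (Ideal.span {(p : ℤ)}).IsMaximal :=
    PrincipalIdealRing.isMaximal_of_irreducible (Nat.prime_iff_prime_int.1 hp).irreducible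
  obtain ⟨hDVR, hpD, hcardD, hγD, ⟨ψ⟩⟩ := exists_localization_equiv hp hh he hG hGe hE hN hP0
    hpP hcard hγP hw hγw hβ' hγ (Localization.AtPrime P)
  refine ⟨K, inferInstance, inferInstance, hK, L, inferInstance, inferInstance, inferInstance, hL,
    hKf, hLe, (hh.isPrime_span hp hKf hβ).1, P, hPprime, ⟨?_⟩, fun Q hQ hQp => ?_, ?_, hDVR, hpD, hcardD, ⟨γ, rfl, hγD⟩, ⟨φ.symm.trans ψ⟩⟩
  · refine hmaxZ.eq_of_le (Ideal.comap_ne_top _ hPmax.ne_top) ?_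
    rw [Ideal.span_singleton_le_iff_mem, Ideal.mem_comap]
    simpa using hpmem
  · have hpQ : (p : 𝓞 L) ∈ Q := by
      have h1 : (p : ℤ) ∈ Q.under ℤ := hQp.over ▸ Ideal.mem_span_singleton_self _
      simpa [Ideal.mem_comap] using h1
    -- A prime above `p` contains `(p) = P ^ e`, hence contains the maximal ideal `P`.
    refine (hPmax.eq_of_le hQ.ne_top (Ideal.IsPrime.le_of_pow_le (n := e) ?_)).symm
    rwa [← hpP, Ideal.span_singleton_le_iff_mem]
  · rw [Ideal.map_span, Set.image_singleton, map_natCast, hpP]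

end NumberFieldModel

/-! ### The main theorem -/

theorem theorem1 (R : Type u) [CommRing R] [Finite R] [IsLocalRing R]
    [IsPrincipalIdealRing R] (a e f p : ℕ) (hR : HasParameters R a e f p)
    (π : R) (hπ : IsUniformizer R π) :
    -- the equicharacteristic case
    (e = a →
      Nonempty (R ≃+* (ResidueField R)[X] ⧸ Ideal.span {(X : (ResidueField R)[X]) ^ a}) ∧
      ∀ (R' : Type v) [CommRing R'], IsFiniteLocalPIR R' a a f p → Nonempty (R ≃+* R')) ∧
    -- existence and uniqueness of the coefficient ring `S`, and the remaining case
    ∃ S : Subring R, IsCoefficientRing R p S ∧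
      (∀ S' : Subring R, IsCoefficientRing R p S' → S' = S) ∧
      (e < a →
        -- (3) the signature `(a, e, f, p, Δ)` determines the isomorphism type
        (∀ (R' : Type v) [CommRing R'] [Finite R'] [IsLocalRing R'] [IsPrincipalIdealRing R']
          (a' e' f' p' : ℕ), HasParameters R' a' e' f' p' →
          ∀ S' : Subring R', IsCoefficientRing R' p' S' →
          (Nonempty (R ≃+* R') ↔
            a = a' ∧ e = e' ∧ f = f' ∧ p = p' ∧
            ∃ σ : S ≃+* S', Polynomial.map (σ : S →+* S') '' eisensteinWithZero S p e =
              eisensteinWithZero S' p' e')) ∧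
        -- (4) zeros of polynomials in `Δ` are uniformizers
        (∀ q ∈ eisensteinWithZero S p e, ∀ u : R, q.eval₂ S.subtype u = 0 → IsUniformizer R u) ∧
        -- (1) an Eisenstein polynomial `g` with zero `π`
        ∃ g : S[X], IsPEisenstein p e g ∧ g.eval₂ S.subtype π = 0 ∧
          -- (2) `R` as a quotient of `S[Y]/(g)`
          IsFiniteLocalPIR (AdjoinRoot g) ((a ⌈/⌉ e) * e) e f p ∧
          Nonempty (R ≃+* AdjoinRoot g ⧸ Ideal.span {AdjoinRoot.root g ^ a}) ∧
          Nonempty (R ≃+* S[X] ⧸ Ideal.span {X ^ a, g}) ∧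
          -- (5), (6): number field model and explicit presentation
          (∃ h : ℤ[X], IsInertPolynomial f p h) ∧
          ∀ h : ℤ[X], IsInertPolynomial f p h →
            (∃ b : R, aeval b h = 0) ∧
            ∀ b : R, aeval b h = 0 →
              ∃ G : ℤ[X][X], G.Monic ∧ G.natDegree = e ∧
                IsPEisenstein p e (G.map (AdjoinRoot.mk h)) ∧
                G.map (aeval b : ℤ[X] →ₐ[ℤ] R).toRingHom = g.map S.subtype ∧
                HasNumberFieldModel R a e f p h G ∧
                ∃ φ : (ℤ[X][X] ⧸ presentationIdeal (p ^ (a ⌈/⌉ e)) a h G) ≃+* R,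
                  φ (Ideal.Quotient.mk _ (C X)) = b ∧ φ (Ideal.Quotient.mk _ X) = π) := by
  refine ⟨?_, ?_⟩
  · rintro rfl
    refine ⟨hR.nonempty_equiv_quotient_X_pow hπ, fun R' _ hR' => ?_⟩
    obtain ⟨_, _, _, hR'⟩ := hR'
    obtain ⟨π', hπ'⟩ := (IsPrincipalIdealRing.principal (maximalIdeal R')).principal
    exact hR.nonempty_ringEquiv_of_eq hπ hR' hπ'
  obtain ⟨h₀, hh₀⟩ := exists_isInertPolynomial hR.prime hR.f_ne_zero
  obtain ⟨b₀, hb₀⟩ := hR.exists_root hh₀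
  have hS := hR.isCoefficientRing_intAdjoin hh₀ hb₀
  refine ⟨intAdjoin b₀, hS, fun S' hS' => hS'.eq_intAdjoin hR hh₀ hb₀, fun hea => ⟨?_, ?_, ?_⟩⟩
  · intro R' _ _ _ _ a' e' f' p' hR' S' hS'
    obtain ⟨π', hπ'⟩ := (IsPrincipalIdealRing.principal (maximalIdeal R')).principal
    exact nonempty_ringEquiv_iff hR hR' hπ hπ' hea hS hS'
  · exact fun q hq u hu => hS.isUniformizer_of_eval₂_eq_zero hR hπ hea hq.1 hu
  obtain ⟨g, hg, hgπ⟩ := hS.exists_isPEisenstein hR hπ hea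
  refine ⟨g, hg, hgπ, hS.isFiniteLocalPIR_adjoinRoot hR hπ hea hg hgπ,
    hS.nonempty_equiv_adjoinRoot_quotient hR hπ hg hgπ, hS.nonempty_equiv_quotient hR hπ hg hgπ,
    ⟨h₀, hh₀⟩, fun h hh => ⟨hR.exists_root hh, fun b hb => ?_⟩⟩
  obtain ⟨G, hG, hGe, hE, hGg⟩ := hS.exists_integer_lift hR hg hh hb
  have hφ := hR.exists_presentation_equiv hπ hea hh hb hG hGe hE
    (by rw [hGg, eval_map]; exact hgπ)
  obtain ⟨φ, -⟩ := id hφ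
  exact ⟨G, hG, hGe, hE, hGg, hasNumberFieldModel_of_presentation_equiv hR.prime hh hR.e_pos hG hGe
    hE ((ceilDiv_le_iff_le_mul hR.e_pos).1 le_rfl) φ, hφ⟩
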